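/- Let $\mathcal X$ be a finite alphabet. Let $U$ be a universal prefix Turing machine, $K(n|x)=\min\{\ell(p):U(p,x)=n\}$ the conditional prefix complexity of a natural number $n$ given $x\in\mathcal X^*$, and $K(n)=K(n|\epsilon)$. A semimeasure is a function $\rho:\mathcal X^*\to[0,1]$ with $\rho(\epsilon)\le 1$ and $\sum_{a\in\mathcal X}\rho(xa)\le\rho(x)$; it is a measure if equality holds throughout. A function $f\ge 0$ is enumerable (co-enumerable) if the set of pairs $(x,r)$, $r$ a nonnegative rational, with $f(x)>r$ (with $f(x)<r$) is recursively enumerable; a measure $\mu$ is computable if it is enumerable and co-enumerable and $\{x:\mu(x)=0\}$ is decidable. Let $(\nu_i)_i$ be an effective enumeration of all enumerable semimeasures, $K(\mu|x)=\min\{K(i|x):\nu_i=\mu\}$, and let $M(x)=\sum_i 2^{-K(i)}\nu_i(x)$ be Solomonoff's prior. Put $\rho(y|x)=\rho(xy)/\rho(x)$ if $\rho(x)>0$, and $\rho(y|x)=|\mathcal X|^{-\ell(y)}$ if $\rho(x)=0$. Let $\mathrm{Loss}(a,y)\in[0,1]$ for $a\in\mathcal X$ and $y$ in a non-empty set of actions.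 For a measure $\mu$ let $\mu_t=\mu(\cdot|\omega_{<t})$ and $M_t=M(\cdot|\omega_{<t})$ (functions on $\mathcal X$), and let $l_t^\rho=\inf_y\sum_{a\in\mathcal X}\mathrm{Loss}(a,y)\,\rho(a|\omega_{<t})$ for $\rho\in\{\mu,M\}$. Let $s_t=s_t(\omega_{<t})$ be one of: the squared distance $\sum_a(M_t-\mu_t)^2$; the squared absolute distance $\frac12(\sum_a|M_t-\mu_t|)^2$; the Hellinger distance $\sum_a(\sqrt{M_t}-\sqrt{\mu_t})^2$; the Kullback–Leibler divergence $\sum_a\mu_t\ln(\mu_t/M_t)$; the squared Bayes regret $\frac12(l_t^M-l_t^\mu)^2$. Let $\mathbf E$ be the expectation for $\omega$ sampled from $\mu$ and $$D_{l+1:\infty}(\omega_{1:l})=\lim_{n\to\infty}\mathbf E\Big[\ln\frac{\mu(\omega_{l+1:n}|\omega_{1:l})}{M(\omega_{l+1:n}|\omega_{1:l})}\,\Big|\,\omega_{1:l}\Big].$$ Then there is a constant $C$, not depending on $\mu$, $\omega$, $l$, the loss function or the choice of $s_t$, such that for every computable measure $\mu$ the following hold. (i) For every $l\ge 0$ and every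 $\omega_{1:l}\in\mathcal X^l$, the limit $D_{l+1:\infty}(\omega_{1:l})$ exists and is finite, and for each of the five choices of $s_t$ $$\sum_{t=l+1}^\infty \mathbf E[s_t\,|\,\omega_{1:l}]\;\le\; D_{l+1:\infty}(\omega_{1:l})\;\le\;\big(K(\mu|\omega_{1:l})+K(l)\big)\ln 2+C .$$ (ii) If $s_t$ is the squared distance, the squared absolute distance, the Hellinger distance or the squared Bayes regret, then $$\sum_{t=1}^\infty\mathbf E[s_t]\;\le\;\min_{l\ge 0}\big\{\mathbf E[K(\mu|\omega_{1:l})+K(l)]\ln 2+2l\big\}+C .$$ -/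

import Mathlib

open Filter Topology

namespace FuturePrediction

/-! Finite strings over the alphabet `X` are `List X`; programs are `List Bool`; outputs of
machines are natural numbers (objects are described through their numbers). -/

/-! ### Prefix machines and prefix complexity -/

/-- A prefix machine: a partial recursive function of a binary program and an input string
such that, for each input, the set of halting programs is prefix free. -/
def IsPrefixMachine {X : Type*} [Primcodable X] (T : List Bool × List X →. ℕ) : Prop :=
  Partrec T ∧
    ∀ (x : List X) (p q : List Bool), (T (p, x)).Dom → (T (q, x)).Dom → p <+: q → p = q

/-- A universal prefix machine, in the weakest usual sense (additive optimality): it is a prefix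
machine, and every prefix machine is simulated with programs that are longer by at most an
additive constant. -/
def IsUniversalPrefixMachine {X : Type*} [Primcodable X] (U : List Bool × List X →. ℕ) : Prop :=
  IsPrefixMachine U ∧
    ∀ T : List Bool × List X →. ℕ, IsPrefixMachine T →
      ∃ c : ℕ, ∀ (p : List Bool) (x : List X) (n : ℕ), n ∈ T (p, x) →
        ∃ q : List Bool, n ∈ U (q, x) ∧ q.length ≤ p.length + c

/-- Conditional prefix complexity `K(n|x)` of a natural number `n` given a string `x`.
For a universal `U` the set is never empty. -/
noncomputable def condK {X : Type*} (U : List Bool × List X →. ℕ) (n : ℕ) (x : List X) : ℕ :=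
  sInf {k | ∃ p : List Bool, n ∈ U (p, x) ∧ p.length = k}

/-- Prefix complexity `K(n) = K(n|ε)`. -/
noncomputable def prefixK {X : Type*} (U : List Bool × List X →. ℕ) (n : ℕ) : ℕ :=
  condK U n []

/-! ### Enumerable functions, semimeasures, measures -/

/-- A nonnegative real function `f` is enumerable if the set of pairs `(a, r)`, with `r` a
nonnegative rational number given by numerator and denominator, such that `f a > r` is
recursively enumerable. -/
def IsEnumerable {α : Type*} [Primcodable α] (f : α → ℝ) : Prop :=
  REPred fun z : α × ℕ × ℕ => (z.2.1 : ℝ) / ((z.2.2 : ℝ) + 1) < f z.1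

/-- A nonnegative real function `f` is co-enumerable if the set of pairs `(a, r)` with
`f a < r` is recursively enumerable. -/
def IsCoEnumerable {α : Type*} [Primcodable α] (f : α → ℝ) : Prop :=
  REPred fun z : α × ℕ × ℕ => f z.1 < (z.2.1 : ℝ) / ((z.2.2 : ℝ) + 1)

/-- Semimeasures on strings (the values are then in `[0,1]`). -/
def IsSemimeasure {X : Type*} [Fintype X] (ρ : List X → ℝ) : Prop :=
  (∀ x, 0 ≤ ρ x) ∧ ρ [] ≤ 1 ∧ ∀ x, ∑ a : X, ρ (x ++ [a]) ≤ ρ x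

/-- Probability measures on strings. -/
def IsMeasure {X : Type*} [Fintype X] (μ : List X → ℝ) : Prop :=
  (∀ x, 0 ≤ μ x) ∧ μ [] = 1 ∧ ∀ x, ∑ a : X, μ (x ++ [a]) = μ x

/-- Computable measures: enumerable, co-enumerable, and with decidable null set. -/
def IsComputableMeasure {X : Type*} [Fintype X] [Primcodable X] (μ : List X → ℝ) : Prop :=
  IsMeasure μ ∧ IsEnumerable μ ∧ IsCoEnumerable μ ∧ ComputablePred fun x => μ x = 0

/-- `ν 0, ν 1, ν 2, …` is an effective enumeration (repetitions allowed) of the class of all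
enumerable semimeasures: the members are semimeasures, they are enumerable uniformly in the
index, and every enumerable semimeasure occurs. -/
def IsEffectiveEnumeration {X : Type*} [Fintype X] [Primcodable X] (ν : ℕ → List X → ℝ) : Prop :=
  (∀ i, IsSemimeasure (ν i)) ∧
    (IsEnumerable fun z : ℕ × List X => ν z.1 z.2) ∧
    ∀ ρ : List X → ℝ, IsSemimeasure ρ → IsEnumerable ρ → ∃ i, ν i = ρ

/-- `K(μ|x)`: the length of a shortest program that, given `x`, outputs an index of `μ` in the
enumeration `ν`. For a universal `U` and `μ` in the range of `ν` the set is not empty. -/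
noncomputable def measureK {X : Type*} (U : List Bool × List X →. ℕ) (ν : ℕ → List X → ℝ)
    (μ : List X → ℝ) (x : List X) : ℕ :=
  sInf {k | ∃ (i : ℕ) (p : List Bool), ν i = μ ∧ i ∈ U (p, x) ∧ p.length = k}

/-- The universal mixture (Solomonoff prior) `M(x) = ∑ᵢ 2^{-K(i)} νᵢ(x)`. -/
noncomputable def solomonoff {X : Type*} (U : List Bool × List X →. ℕ) (ν : ℕ → List X → ℝ)
    (x : List X) : ℝ :=
  ∑' i : ℕ, (2 : ℝ)⁻¹ ^ prefixK U i * ν i x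

/-! ### Conditional probabilities and expectations -/

open Classical in
/-- The conditional probability `ρ(y|x) = ρ(xy)/ρ(x)`; if `ρ(x) = 0`, the version which is the
uniform measure on the continuations `y` is used. -/
noncomputable def condProb {X : Type*} [Fintype X] (ρ : List X → ℝ) (x y : List X) : ℝ :=
  if ρ x = 0 then ((Fintype.card X : ℝ)⁻¹) ^ y.length else ρ (x ++ y) / ρ x

/-- `E[f(ω_{1:n})]`. -/
noncomputable def expect {X : Type*} [Fintype X] (μ : List X → ℝ) (n : ℕ) (f : List X → ℝ) : ℝ :=
  ∑ y : Fin n → X, μ (List.ofFn y) * f (List.ofFn y)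

/-- `E[f(ω_{1:l+n}) | ω_{1:l} = x]`, where `l` is the length of `x`. -/
noncomputable def condExpect {X : Type*} [Fintype X] (μ : List X → ℝ) (x : List X) (n : ℕ)
    (f : List X → ℝ) : ℝ :=
  ∑ y : Fin n → X, condProb μ x (List.ofFn y) * f (x ++ List.ofFn y)

/-- `D_{l+1:l+n}(x) = E[ln (μ(ω_{l+1:l+n}|x) / ρ(ω_{l+1:l+n}|x)) | ω_{1:l} = x]`, where `l` is
the length of `x`. -/
noncomputable def relEntropy {X : Type*} [Fintype X] (μ ρ : List X → ℝ) (x : List X) (n : ℕ) : ℝ :=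
  ∑ y : Fin n → X, condProb μ x (List.ofFn y) *
    Real.log (condProb μ x (List.ofFn y) / condProb ρ x (List.ofFn y))

/-! ### Distances between one-step predictions

The arguments are the predictive probabilities `r = ρ_t` and `m = μ_t` of the next symbol. -/

/-- Squared distance. -/
noncomputable def sqDist {X : Type*} [Fintype X] (r m : X → ℝ) : ℝ :=
  ∑ a, (r a - m a) ^ 2

/-- Squared absolute distance. -/
noncomputable def sqAbsDist {X : Type*} [Fintype X] (r m : X → ℝ) : ℝ :=
  1 / 2 * (∑ a, |r a - m a|) ^ 2

/-- Hellinger distance. -/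
noncomputable def hellingerDist {X : Type*} [Fintype X] (r m : X → ℝ) : ℝ :=
  ∑ a, (√(r a) - √(m a)) ^ 2

/-- Kullback-Leibler divergence. -/
noncomputable def klDist {X : Type*} [Fintype X] (r m : X → ℝ) : ℝ :=
  ∑ a, m a * Real.log (m a / r a)

/-- The minimal expected loss over all actions `y`. -/
noncomputable def bayesLoss {X Y : Type*} [Fintype X] (Loss : X → Y → ℝ) (r : X → ℝ) : ℝ :=
  ⨅ y : Y, ∑ a, Loss a y * r a

/-- Squared Bayes regret. -/
noncomputable def sqBayesRegret {X Y : Type*} [Fintype X] (Loss : X → Y → ℝ) (r m : X → ℝ) : ℝ :=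
  1 / 2 * (bayesLoss Loss r - bayesLoss Loss m) ^ 2

/-- The four distances that are bounded by `2`. -/
def boundedDistances {X Y : Type*} [Fintype X] (Loss : X → Y → ℝ) :
    Set ((X → ℝ) → (X → ℝ) → ℝ) :=
  {sqDist, sqAbsDist, hellingerDist, sqBayesRegret Loss}

/-- All five distances. -/
def allDistances {X Y : Type*} [Fintype X] (Loss : X → Y → ℝ) :
    Set ((X → ℝ) → (X → ℝ) → ℝ) :=
  {sqDist, sqAbsDist, hellingerDist, klDist, sqBayesRegret Loss}

/-- The deviation `s_t(ω_{<t})` of `ρ_t` from `μ_t` as a function of the past `x = ω_{<t}`. -/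
noncomputable def deviation {X : Type*} [Fintype X] (s : (X → ℝ) → (X → ℝ) → ℝ)
    (ρ μ : List X → ℝ) (x : List X) : ℝ :=
  s (fun a => condProb ρ x [a]) (fun a => condProb μ x [a])

end FuturePrediction

namespace FuturePrediction

/-! ### Computable arithmetic -/

section Computable

variable {α : Type*} [Primcodable α]

/-! Everything rests on one domination inequality, `exists_solomonoff_dominates`: M(xy) ≥ 2^{-(c +
K(l) + K(μ|x))} M(x) μ(y|x), where l is the length of x and c does not depend on μ, x or y. Its
logarithm bounds the relative entropy of the continuations of x by (K(μ|x) + K(l) + c) ln 2. By the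
chain rule (`relEntropy_eq_sum`) this entropy is the sum of the expected one-step Kullback–Leibler
divergences, and each of the other distances is at most that divergence, although M is only a
semimeasure (`pinsker`, `sq_sqrt_sub_le_klTerm`). This gives (i). For (ii) the series is cut at l:
each of the first l terms is at most 2, and the tail is the average of (i) over the strings of
length l.

The inequality comes from a single enumerable semimeasure, `splicedMixture`, that serves all μ and x
at once. Each program for a number l contributes a semimeasure that follows a universal mixture for
l symbols and then, given the past x, a mixture of conditionals ν_i(·|x) weighted by the programs
that compute i from x. This semimeasure occurs in the enumeration, so M dominates it.

The obstacle is enumerability: ν_i(xy)/ν_i(x) need not be lower semicomputable, since its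
denominator is approximated from below. `lowerCond` replaces ν_i(x) by one minus the mass of the
other strings of the same length. This is approximated from above, is at least ν_i(x), so that the
semimeasure inequalities survive, and equals ν_i(x) if ν_i is a measure. -/

theorem computable_mul {f g : α → ℕ} (hf : Computable f) (hg : Computable g) :
    Computable fun a => f a * g a :=
  Primrec.nat_mul.to_comp.comp hf hg

theorem computable_add {f g : α → ℕ} (hf : Computable f) (hg : Computable g) :
    Computable fun a => f a + g a :=
  Primrec.nat_add.to_comp.comp hf hg

theorem computable_sub {f g : α → ℕ} (hf : Computable f) (hg : Computable g) :
    Computable fun a => f a - g a :=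
  Primrec.nat_sub.to_comp.comp hf hg

theorem computable_div {f g : α → ℕ} (hf : Computable f) (hg : Computable g) :
    Computable fun a => f a / g a :=
  Primrec.nat_div.to_comp.comp hf hg

theorem computable_max {f g : α → ℕ} (hf : Computable f) (hg : Computable g) :
    Computable fun a => max (f a) (g a) :=
  Primrec.nat_max.to_comp.comp hf hg

theorem computable_pow {f g : α → ℕ} (hf : Computable f) (hg : Computable g) :
    Computable fun a => f a ^ g a :=
  (Primrec₂.unpaired'.1 Nat.Primrec.pow).to_comp.comp hf hg

theorem computable_lt {f g : α → ℕ} (hf : Computable f) (hg : Computable g) :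
    Computable fun a => decide (f a < g a) :=
  (Primrec.nat_lt.decide.to_comp).comp hf hg

theorem computable_decide_eq {β : Type*} [Primcodable β] [DecidableEq β] {f g : α → β}
    (hf : Computable f) (hg : Computable g) : Computable fun a => decide (f a = g a) :=
  (Primrec.eq.decide.to_comp).comp hf hg

theorem computable_sum_range {f : α → ℕ} {g : α → ℕ → ℕ} (hf : Computable f)
    (hg : Computable₂ g) : Computable fun a => ∑ k ∈ Finset.range (f a), g a k := by
  refine (Computable.nat_rec hf (Computable.const 0)
    (h := fun a p => p.2 + g a p.1) ?_).of_eq fun a => ?_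
  · exact computable_add (Computable.snd.comp Computable.snd)
      (hg.comp Computable.fst (Computable.fst.comp Computable.snd))
  · induction f a with
    | zero => rfl
    | succ n ih => rw [Finset.sum_range_succ, ← ih]

/-- A partial recursive function is the limit of its computable step-bounded versions. -/
theorem exists_stages {β : Type*} [Primcodable β] {g : α →. β} (hg : Partrec g) :
    ∃ G : α → ℕ → Option β, Computable₂ G ∧
      (∀ a s t b, s ≤ t → G a s = some b → G a t = some b) ∧
      ∀ a b, b ∈ g a ↔ ∃ t, G a t = some b := by
  obtain ⟨c, hc⟩ := Nat.Partrec.Code.exists_code.1 hg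
  refine ⟨fun a t => (Nat.Partrec.Code.evaln t c (Encodable.encode a)).bind Encodable.decode,
    ?_, ?_, ?_⟩
  · refine Computable.option_bind (Nat.Partrec.Code.primrec_evaln.to_comp.comp
      ((Computable.snd.pair (Computable.const c)).pair
        (Computable.encode.comp Computable.fst))) ?_
    exact Computable.decode.comp Computable.snd
  · intro a s t b hst h
    simp only [Option.bind_eq_some_iff] at h ⊢
    obtain ⟨n, hn, hb⟩ := h
    exact ⟨n, Nat.Partrec.Code.evaln_mono hst hn, hb⟩
  · intro a b
    have key : ∀ n, n ∈ Nat.Partrec.Code.eval c (Encodable.encode a) ↔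
        ∃ b ∈ g a, Encodable.encode b = n := by
      intro n
      rw [hc]
      simp
    simp only [Option.bind_eq_some_iff]
    constructor
    · intro hb
      obtain ⟨t, ht⟩ := Nat.Partrec.Code.evaln_complete.1 ((key _).2 ⟨b, hb, rfl⟩)
      exact ⟨t, _, ht, Encodable.encodek b⟩
    · rintro ⟨t, n, hn, hb⟩
      obtain ⟨b', hb', rfl⟩ := (key n).1 (Nat.Partrec.Code.evaln_sound hn)
      rw [Encodable.encodek] at hb
      exact (Option.some.inj hb) ▸ hb'

end Computable

/-! ### Lower semicomputable functions -/

/-- A nonnegative real function is lower semicomputable if it is the limit of an increasing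
computable sequence of dyadic functions, the `t`-th of which has denominator `2 ^ t`. -/
def LowerSemicomputable {α : Type*} [Primcodable α] (f : α → ℝ) : Prop :=
  ∃ A : α → ℕ → ℕ, Computable₂ A ∧ (∀ a t, 2 * A a t ≤ A a (t + 1)) ∧
    ∀ a, Tendsto (fun t => (A a t : ℝ) / 2 ^ t) atTop (𝓝 (f a))

theorem monotone_dyadic {A : ℕ → ℕ} (h : ∀ t, 2 * A t ≤ A (t + 1)) :
    Monotone fun t => (A t : ℝ) / 2 ^ t := by
  refine monotone_nat_of_le_succ fun t => ?_
  have : (2 : ℝ) * A t ≤ A (t + 1) := by exact_mod_cast h t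
  rw [pow_succ, div_le_div_iff₀ (by positivity) (by positivity)]
  nlinarith [pow_pos (two_pos : (0 : ℝ) < 2) t]

theorem dyadic_le {A : ℕ → ℕ} {x : ℝ} (h : ∀ t, 2 * A t ≤ A (t + 1))
    (hx : Tendsto (fun t => (A t : ℝ) / 2 ^ t) atTop (𝓝 x)) (t : ℕ) : (A t : ℝ) / 2 ^ t ≤ x :=
  (monotone_dyadic h).ge_of_tendsto hx t

theorem tendsto_dyadic_of_forall_le {A : ℕ → ℕ} {x : ℝ} (h : ∀ t, 2 * A t ≤ A (t + 1))
    (hle : ∀ t, (A t : ℝ) / 2 ^ t ≤ x) (hlt : ∀ y < x, ∃ t, y < (A t : ℝ) / 2 ^ t) :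
    Tendsto (fun t => (A t : ℝ) / 2 ^ t) atTop (𝓝 x) := by
  refine tendsto_atTop_isLUB (monotone_dyadic h) ⟨?_, ?_⟩
  · rintro _ ⟨t, rfl⟩
    exact hle t
  · intro b hb
    by_contra hc
    obtain ⟨t, ht⟩ := hlt b (not_le.1 hc)
    exact absurd (hb ⟨t, rfl⟩) (not_le.2 ht)

/-- Rounding down to a multiple of `2 ^ (-t)` does not change the limit. -/
theorem tendsto_dyadic_natDiv {m n : ℕ → ℕ} {x : ℝ}
    (h : Tendsto (fun t => (m t : ℝ) / n t / 2 ^ t) atTop (𝓝 x)) :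
    Tendsto (fun t => ((m t / n t : ℕ) : ℝ) / 2 ^ t) atTop (𝓝 x) := by
  have h2 : Tendsto (fun t : ℕ => (1 / 2 : ℝ) ^ t) atTop (𝓝 0) :=
    tendsto_pow_atTop_nhds_zero_of_lt_one (by norm_num) (by norm_num)
  have h3 := h.sub h2
  rw [sub_zero] at h3
  refine tendsto_of_tendsto_of_tendsto_of_le_of_le h3 h (fun t => ?_) fun t => ?_
  · have : (m t : ℝ) / n t - 1 ≤ (m t / n t : ℕ) := by
      rw [← Nat.floor_div_eq_div (K := ℝ)]
      exact (Nat.sub_one_lt_floor _).le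
    rw [one_div, inv_pow, ← one_div, ← sub_div]
    gcongr
  · simp only
    gcongr
    exact Nat.cast_div_le

/-! ### Arithmetic closure properties of lower semicomputable functions. -/

namespace LowerSemicomputable

variable {α β : Type*} [Primcodable α] [Primcodable β] {f g : α → ℝ}

theorem nonneg (hf : LowerSemicomputable f) (a : α) : 0 ≤ f a := by
  obtain ⟨A, -, -, hA⟩ := hf
  exact ge_of_tendsto' (hA a) fun t => by positivity

theorem of_eq (hf : LowerSemicomputable f) (h : ∀ a, f a = g a) : LowerSemicomputable g :=
  (funext h : f = g) ▸ hf

theorem comp {f : β → ℝ} (hf : LowerSemicomputable f) {k : α → β} (hk : Computable k) :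
    LowerSemicomputable fun a => f (k a) := by
  obtain ⟨A, hA, hm, hl⟩ := hf
  exact ⟨fun a t => A (k a) t, hA.comp (hk.comp Computable.fst) Computable.snd,
    fun a => hm _, fun a => hl _⟩

/-- An unbounded search for a stage whose dyadic value exceeds the given rational halts exactly when
the limit exceeds it. -/
theorem isEnumerable (hf : LowerSemicomputable f) : IsEnumerable f := by
  obtain ⟨A, hA, hm, hl⟩ := hf
  have hp : Partrec fun z : α × ℕ × ℕ => Nat.rfind fun t =>
      Part.some (decide (z.2.1 * 2 ^ t < A z.1 t * (z.2.2 + 1))) := by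
    refine Partrec.rfind (Computable.partrec (computable_lt (computable_mul ?_ ?_)
      (computable_mul ?_ ?_)))
    · exact Computable.fst.comp (Computable.snd.comp Computable.fst)
    · exact computable_pow (Computable.const 2) Computable.snd
    · exact hA.comp (Computable.fst.comp Computable.fst) Computable.snd
    · exact Computable.succ.comp (Computable.snd.comp (Computable.snd.comp Computable.fst))
  refine hp.dom_re.of_eq fun z => ?_
  have h1 : ∀ t, z.2.1 * 2 ^ t < A z.1 t * (z.2.2 + 1) ↔
      (z.2.1 : ℝ) / ((z.2.2 : ℝ) + 1) < (A z.1 t : ℝ) / 2 ^ t := by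
    intro t
    rw [div_lt_div_iff₀ (by positivity) (by positivity)]
    exact_mod_cast Iff.rfl
  refine Nat.rfind_dom.trans ?_
  simp only [Part.mem_some_iff, Part.some_dom, implies_true, and_true, eq_comm (a := true),
    decide_eq_true_eq, h1]
  constructor
  · rintro ⟨t, ht⟩
    exact ht.trans_le (dyadic_le (hm _) (hl _) t)
  · intro h
    exact ((hl z.1).eventually_const_lt h).exists

theorem zero : LowerSemicomputable fun _ : α => (0 : ℝ) :=
  ⟨fun _ _ => 0, Computable.const 0, by simp, by simp⟩

theorem add (hf : LowerSemicomputable f) (hg : LowerSemicomputable g) :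
    LowerSemicomputable fun a => f a + g a := by
  obtain ⟨A, hA, hAm, hAl⟩ := hf
  obtain ⟨B, hB, hBm, hBl⟩ := hg
  refine ⟨fun a t => A a t + B a t, computable_add hA hB, fun a t => ?_, fun a => ?_⟩
  · have := hAm a t
    have := hBm a t
    dsimp only
    omega
  · simpa only [Nat.cast_add, add_div] using (hAl a).add (hBl a)

theorem mul (hf : LowerSemicomputable f) (hg : LowerSemicomputable g) :
    LowerSemicomputable fun a => f a * g a := by
  obtain ⟨A, hA, hAm, hAl⟩ := hf
  obtain ⟨B, hB, hBm, hBl⟩ := hg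
  -- The product of two stages has denominator 4^t; the floor division rounds it down to denominator
  -- 2^t.
  refine ⟨fun a t => A a t * B a t / 2 ^ t, computable_div (computable_mul hA hB)
    (computable_pow (Computable.const 2) Computable.snd), fun a t => ?_, fun a => ?_⟩
  · rw [Nat.le_div_iff_mul_le (by positivity)]
    calc 2 * (A a t * B a t / 2 ^ t) * 2 ^ (t + 1)
        = 4 * (A a t * B a t / 2 ^ t * 2 ^ t) := by ring
      _ ≤ 4 * (A a t * B a t) := Nat.mul_le_mul_left _ (Nat.div_mul_le_self _ _)
      _ = (2 * A a t) * (2 * B a t) := by ring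
      _ ≤ _ := Nat.mul_le_mul (hAm a t) (hBm a t)
  · refine tendsto_dyadic_natDiv (((hAl a).mul (hBl a)).congr fun t => ?_)
    push_cast
    field_simp

theorem inv_natCast {k : α → ℕ} (hk : Computable k) :
    LowerSemicomputable fun a => ((k a : ℝ))⁻¹ := by
  refine ⟨fun a t => 2 ^ t / k a, computable_div (computable_pow (Computable.const 2)
    Computable.snd) (hk.comp Computable.fst), fun a t => ?_, fun a => ?_⟩
  · calc 2 * (2 ^ t / k a) ≤ 2 * 2 ^ t / k a := Nat.mul_div_le_mul_div_assoc _ _ _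
      _ = 2 ^ (t + 1) / k a := by rw [pow_succ']
  · refine tendsto_dyadic_natDiv (tendsto_const_nhds.congr fun t => ?_)
    push_cast
    field_simp

theorem cond {c : α → Bool} (hc : Computable c) (hf : LowerSemicomputable f)
    (hg : LowerSemicomputable g) : LowerSemicomputable fun a => bif c a then f a else g a := by
  obtain ⟨A, hA, hAm, hAl⟩ := hf
  obtain ⟨B, hB, hBm, hBl⟩ := hg
  refine ⟨fun a t => bif c a then A a t else B a t,
    Computable.cond (hc.comp Computable.fst) hA hB, fun a t => ?_, fun a => ?_⟩
  · dsimp only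
    cases c a
    exacts [hBm a t, hAm a t]
  · dsimp only
    cases c a
    exacts [hBl a, hAl a]

/-- The quotient of `f` by the upper semicomputable function `1 - g`. -/
theorem div_one_sub (hf : LowerSemicomputable f) (hg : LowerSemicomputable g)
    (hfg : ∀ a, f a ≤ 1 - g a) : LowerSemicomputable fun a => f a / (1 - g a) := by
  have hf0 := hf.nonneg
  obtain ⟨A, hA, hAm, hAl⟩ := hf
  obtain ⟨B, hB, hBm, hBl⟩ := hg
  have hBle : ∀ a t, B a t ≤ 2 ^ t := by
    intro a t
    have h1 := dyadic_le (hBm a) (hBl a) t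
    have h2 : (B a t : ℝ) / 2 ^ t ≤ 1 := by linarith [hfg a, hf0 a]
    rw [div_le_one (by positivity)] at h2
    exact_mod_cast h2
  -- If a stage of g already reaches 1, then f vanishes and so do all its stages; the division by
  -- zero in the approximation is therefore harmless.
  have hzero : ∀ a t, 2 ^ t - B a t = 0 → f a = 0 := by
    intro a t h0
    have h1 := dyadic_le (hBm a) (hBl a) t
    have h2 : B a t = 2 ^ t := le_antisymm (hBle a t) (by omega)
    rw [h2] at h1
    push_cast at h1
    rw [div_self (by positivity)] at h1
    exact le_antisymm (by linarith [hfg a]) (hf0 a)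
  have hAzero : ∀ a t, f a = 0 → A a t = 0 := by
    intro a t h0
    have h1 := dyadic_le (hAm a) (hAl a) t
    rw [h0] at h1
    by_contra hne
    have : (0 : ℝ) < A a t := by exact_mod_cast Nat.pos_of_ne_zero hne
    exact absurd h1 (not_le.2 (by positivity))
  refine ⟨fun a t => A a t * 2 ^ t / (2 ^ t - B a t), computable_div (computable_mul hA
    (computable_pow (Computable.const 2) Computable.snd)) (computable_sub
    (computable_pow (Computable.const 2) Computable.snd) hB), fun a t => ?_, fun a => ?_⟩
  · rcases Nat.eq_zero_or_pos (2 ^ (t + 1) - B a (t + 1)) with h0 | hpos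
    · simp [hAzero a t (hzero a _ h0)]
    · rw [Nat.le_div_iff_mul_le hpos]
      -- The approximations of 1 - g decrease, so those of the quotient increase.
      have h1 : 2 ^ (t + 1) - B a (t + 1) ≤ 2 * (2 ^ t - B a t) := by
        have := hBm a t
        rw [pow_succ']
        omega
      calc 2 * (A a t * 2 ^ t / (2 ^ t - B a t)) * (2 ^ (t + 1) - B a (t + 1))
          ≤ 2 * (A a t * 2 ^ t / (2 ^ t - B a t)) * (2 * (2 ^ t - B a t)) := by gcongr
        _ = 4 * (A a t * 2 ^ t / (2 ^ t - B a t) * (2 ^ t - B a t)) := by ring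
        _ ≤ 4 * (A a t * 2 ^ t) := Nat.mul_le_mul_left _ (Nat.div_mul_le_self _ _)
        _ = 2 * A a t * 2 ^ (t + 1) := by ring
        _ ≤ _ := by gcongr; exact hAm a t
  · by_cases h0 : f a = 0
    · simp [hAzero a _ h0, h0]
    · have hne : 1 - g a ≠ 0 := fun h => h0 (le_antisymm (h ▸ hfg a) (hf0 a))
      refine tendsto_dyadic_natDiv (((hAl a).div (tendsto_const_nhds.sub (hBl a)) hne).congr
        fun t => ?_)
      have hB' : (2 : ℝ) ^ t - B a t ≠ 0 := by
        intro h
        refine h0 (hzero a t ?_)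
        have : (2 : ℝ) ^ t = B a t := by linarith
        have : 2 ^ t = B a t := by exact_mod_cast this
        omega
      have : (1 : ℝ) - B a t / 2 ^ t ≠ 0 := by
        rw [one_sub_div (by positivity)]
        exact div_ne_zero hB' (by positivity)
      simp only [Pi.div_apply]
      push_cast [hBle a t]
      field_simp

end LowerSemicomputable
/-- The maximum of `b 0, …, b (n - 1)`. -/
def partialMax (b : ℕ → ℕ) (n : ℕ) : ℕ := Nat.rec 0 (fun w m => max m (b w)) n

open Classical in
/-- The value of `F` at the element of `o`, and `0` if `o` is undefined. -/
noncomputable def partVal {β : Type*} (o : Part β) (F : β → ℝ) : ℝ :=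
  if h : o.Dom then F (o.get h) else 0

section partVal

variable {β : Type*} {o : Part β} {F G : β → ℝ}

theorem partVal_of_mem {b : β} (h : b ∈ o) : partVal o F = F b := by
  obtain ⟨hd, rfl⟩ := h
  exact dif_pos hd

theorem partVal_of_not_dom (h : ¬ o.Dom) : partVal o F = 0 := dif_neg h

theorem partVal_some (b : β) : partVal (Part.some b) F = F b :=
  partVal_of_mem (Part.mem_some b)

theorem partVal_mono (h : ∀ b, F b ≤ G b) : partVal o F ≤ partVal o G := by
  by_cases hd : o.Dom
  · simpa only [partVal, dif_pos hd] using h _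
  · simp only [partVal, dif_neg hd, le_refl]

theorem partVal_nonneg (h : ∀ b, 0 ≤ F b) : 0 ≤ partVal o F := by
  by_cases hd : o.Dom
  · simpa only [partVal, dif_pos hd] using h _
  · simp only [partVal, dif_neg hd, le_refl]

theorem partVal_sum {ι : Type*} (s : Finset ι) (F : ι → β → ℝ) :
    partVal o (fun b => ∑ i ∈ s, F i b) = ∑ i ∈ s, partVal o (F i) := by
  by_cases hd : o.Dom
  · simp only [partVal, dif_pos hd]
  · simp only [partVal, dif_neg hd, Finset.sum_const_zero]

end partVal

/-! ### Partial computations, infinite series and enumerable functions. -/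

namespace LowerSemicomputable

variable {α β : Type*} [Primcodable α] [Primcodable β]

/-- Stage t is zero until the computation of `g a` halts within t steps, and follows the stages of F
from then on. -/
theorem partVal {F : α × β → ℝ} (hF : LowerSemicomputable F) {g : α → Part β} (hg : Partrec g) :
    LowerSemicomputable fun a => FuturePrediction.partVal (g a) fun b => F (a, b) := by
  obtain ⟨A, hA, hAm, hAl⟩ := hF
  obtain ⟨G, hG, hGm, hGl⟩ := exists_stages hg
  have hm : ∀ a t, 2 * ((G a t).elim 0 fun b => A (a, b) t) ≤
      (G a (t + 1)).elim 0 fun b => A (a, b) (t + 1) := by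
    intro a t
    cases h : G a t with
    | none => simp
    | some b =>
      rw [hGm a t (t + 1) b t.le_succ h]
      exact hAm (a, b) t
  refine ⟨fun a t => (G a t).elim 0 fun b => A (a, b) t, ?_, hm, fun a => ?_⟩
  · refine (Computable.option_casesOn hG (Computable.const 0)
      (g := fun p b => A (p.1, b) p.2) ?_).of_eq fun p => ?_
    · exact hA.comp ((Computable.fst.comp Computable.fst).pair Computable.snd)
        (Computable.snd.comp Computable.fst)
    · dsimp only
      cases G p.1 p.2 <;> rfl
  · by_cases hd : (g a).Dom
    · have hb := Part.get_mem hd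
      simp only [partVal_of_mem hb]
      obtain ⟨T, hT⟩ := (hGl _ _).1 hb
      refine (hAl (a, (g a).get hd)).congr' ?_
      filter_upwards [eventually_ge_atTop T] with t ht
      rw [hGm a T t _ ht hT, Option.elim_some]
    · simp only [partVal_of_not_dom hd]
      refine tendsto_const_nhds.congr fun t => ?_
      cases h : G a t with
      | none => simp
      | some b => exact absurd (Part.dom_iff_mem.2 ⟨b, (hGl a b).2 ⟨t, h⟩⟩) hd

/-- Stage t adds the t-th stages of the first t terms. As all terms are nonnegative, any finite
partial sum is eventually approximated. -/
theorem tsum_nat {f : α × ℕ → ℝ} (hf : LowerSemicomputable f)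
    (hs : ∀ a, Summable fun k => f (a, k)) :
    LowerSemicomputable fun a => ∑' k, f (a, k) := by
  have hf0 := hf.nonneg
  obtain ⟨A, hA, hAm, hAl⟩ := hf
  have hm : ∀ a t, 2 * ∑ k ∈ Finset.range t, A (a, k) t ≤
      ∑ k ∈ Finset.range (t + 1), A (a, k) (t + 1) := by
    intro a t
    rw [Finset.mul_sum, Finset.sum_range_succ]
    exact (Finset.sum_le_sum fun k _ => hAm (a, k) t).trans (Nat.le_add_right _ _)
  refine ⟨fun a t => ∑ k ∈ Finset.range t, A (a, k) t, ?_, hm, fun a => ?_⟩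
  · refine computable_sum_range Computable.snd (g := fun p k => A (p.1, k) p.2) ?_
    exact hA.comp ((Computable.fst.comp Computable.fst).pair Computable.snd)
      (Computable.snd.comp Computable.fst)
  · refine tendsto_dyadic_of_forall_le (hm a) (fun t => ?_) fun y hy => ?_
    · push_cast
      rw [Finset.sum_div]
      exact (Finset.sum_le_sum fun k _ => dyadic_le (hAm (a, k)) (hAl (a, k)) t).trans
        ((hs a).sum_le_tsum _ fun k _ => hf0 _)
    · obtain ⟨N, hN⟩ := ((hs a).hasSum.tendsto_sum_nat.eventually_const_lt hy).exists
      have h1 : Tendsto (fun t => ∑ k ∈ Finset.range N, (A (a, k) t : ℝ) / 2 ^ t) atTop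
          (𝓝 (∑ k ∈ Finset.range N, f (a, k))) := tendsto_finsetSum _ fun k _ => hAl (a, k)
      obtain ⟨t, ht, htN⟩ := ((h1.eventually_const_lt hN).and (eventually_ge_atTop N)).exists
      refine ⟨t, ht.trans_le ?_⟩
      push_cast
      rw [Finset.sum_div]
      exact Finset.sum_le_sum_of_subset_of_nonneg (Finset.range_mono htN)
        fun k _ _ => by positivity

/-- The series is reindexed by codes. `decode₂` rejects every number other than the canonical code
of an element, so each term is counted exactly once. -/
theorem tsum {f : α × β → ℝ} (hf : LowerSemicomputable f)
    (hs : ∀ a, Summable fun b => f (a, b)) :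
    LowerSemicomputable fun a => ∑' b, f (a, b) := by
  have h1 : LowerSemicomputable fun p : α × ℕ =>
      FuturePrediction.partVal (Encodable.decode₂ β p.2 : Part β) fun b => f (p.1, b) := by
    refine LowerSemicomputable.partVal (F := fun q : (α × ℕ) × β => f (q.1.1, q.2)) ?_ ?_
    · exact hf.comp ((Computable.fst.comp Computable.fst).pair Computable.snd)
    · exact Computable.ofOption (Primrec.decode₂.to_comp.comp Computable.snd)
  have hval : ∀ a b, FuturePrediction.partVal
      (Encodable.decode₂ β (Encodable.encode b) : Part β) (fun b => f (a, b)) = f (a, b) := by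
    intro a b
    rw [Encodable.decode₂_encode]
    exact partVal_some b
  have hzero : ∀ a, ∀ k ∉ Set.range (Encodable.encode : β → ℕ), FuturePrediction.partVal
      (Encodable.decode₂ β k : Part β) (fun b => f (a, b)) = 0 := by
    intro a k hk
    cases h : Encodable.decode₂ β k with
    | none => exact partVal_of_not_dom fun h => h
    | some b => exact absurd ⟨b, Encodable.decode₂_eq_some.1 h⟩ hk
  refine (h1.tsum_nat fun a => ?_).of_eq fun a => ?_
  · refine (Encodable.encode_injective.summable_iff (hzero a)).1 ?_
    simpa only [Function.comp_def, hval] using hs a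
  · rw [← Encodable.encode_injective.tsum_eq (Function.support_subset_iff'.2 (hzero a))]
    simp only [hval]

/-- A value f(a) is the supremum of 0 and the rationals certified to lie below it. Stage t is the
maximum, over the codes w < t, of the certified rationals rounded down to multiples of 2^{-t}. -/
theorem of_isEnumerable {f : α → ℝ} (hf : IsEnumerable f) (h0 : ∀ a, 0 ≤ f a) :
    LowerSemicomputable f := by
  obtain ⟨G, hG, -, hGl⟩ := exists_stages hf
  have hG' : ∀ z : α × ℕ × ℕ, ((z.2.1 : ℝ) / ((z.2.2 : ℝ) + 1) < f z.1) ↔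
      ∃ t, G z t = some () := by
    intro z
    rw [← hGl]
    simp
  -- `w` codes a numerator, a denominator and the time at which the bound is verified
  obtain ⟨q, hqc, hqs⟩ : ∃ q : ℕ → ℕ × ℕ × ℕ, Computable q ∧ Function.Surjective q :=
    ⟨Denumerable.ofNat _, Computable.ofNat _, fun z => ⟨_, Denumerable.ofNat_encode z⟩⟩
  let B : α → ℕ → ℕ → ℕ := fun a t w =>
    bif (G (a, (q w).1, (q w).2.1) (q w).2.2).isSome then
      2 ^ t * (q w).1 / ((q w).2.1 + 1) else 0
  have hB2 : ∀ a t w, 2 * B a t w ≤ B a (t + 1) w := by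
    intro a t w
    simp only [B]
    cases (G (a, (q w).1, (q w).2.1) (q w).2.2).isSome
    · simp
    · simp only [cond_true, pow_succ', mul_assoc]
      exact Nat.mul_div_le_mul_div_assoc _ _ _
  let S : α → ℕ → ℕ → ℕ := fun a t n => partialMax (B a t) n
  have hSsucc : ∀ a t n, S a t (n + 1) = max (S a t n) (B a t n) := fun _ _ _ => rfl
  have hS2 : ∀ a t n, 2 * S a t n ≤ S a (t + 1) n := by
    intro a t n
    induction n with
    | zero => exact le_rfl
    | succ n ih =>
      have := hB2 a t n
      rw [hSsucc, hSsucc]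
      omega
  have hSB : ∀ a t n w, w < n → B a t w ≤ S a t n := by
    intro a t n w hw
    induction n with
    | zero => omega
    | succ n ih =>
      rw [hSsucc]
      rcases Nat.lt_succ_iff_lt_or_eq.1 hw with h | rfl
      · exact (ih h).trans (le_max_left _ _)
      · exact le_max_right _ _
  have hBle : ∀ a t w, (B a t w : ℝ) / 2 ^ t ≤ f a := by
    intro a t w
    simp only [B]
    cases h : (G (a, (q w).1, (q w).2.1) (q w).2.2).isSome
    · simpa using h0 a
    · obtain ⟨u, hu⟩ := Option.isSome_iff_exists.1 h
      have := (hG' (a, (q w).1, (q w).2.1)).2 ⟨_, hu⟩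
      refine le_trans ?_ this.le
      rw [div_le_iff₀ (by positivity)]
      refine Nat.cast_div_le.trans (le_of_eq ?_)
      push_cast
      ring
  have hSle : ∀ (a : α) (t n : ℕ), (S a t n : ℝ) / 2 ^ t ≤ f a := by
    intro a t n
    induction n with
    | zero => simpa [S, partialMax] using h0 a
    | succ n ih =>
      rw [hSsucc]
      rcases max_choice (S a t n) (B a t n) with h | h <;> simp only [h]
      exacts [ih, hBle a t n]
  have hm : ∀ a t, 2 * S a t t ≤ S a (t + 1) (t + 1) := fun a t =>
    (hS2 a t t).trans ((le_max_left _ _).trans (hSsucc a (t + 1) t).ge)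
  refine ⟨fun a t => S a t t, ?_, hm, fun a => tendsto_dyadic_of_forall_le (hm a)
    (fun t => hSle a t t) fun y hy => ?_⟩
  · have hw : Computable fun p : (α × ℕ) × (ℕ × ℕ) => p.2.1 :=
      Computable.fst.comp Computable.snd
    have hq' := hqc.comp hw
    have ha : Computable fun p : (α × ℕ) × (ℕ × ℕ) => p.1.1 :=
      Computable.fst.comp Computable.fst
    have ht : Computable fun p : (α × ℕ) × (ℕ × ℕ) => p.1.2 :=
      Computable.snd.comp Computable.fst
    have hm' : Computable fun p : (α × ℕ) × (ℕ × ℕ) => (q p.2.1).1 := Computable.fst.comp hq'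
    have hn' : Computable fun p : (α × ℕ) × (ℕ × ℕ) => (q p.2.1).2.1 :=
      Computable.fst.comp (Computable.snd.comp hq')
    have hu' : Computable fun p : (α × ℕ) × (ℕ × ℕ) => (q p.2.1).2.2 :=
      Computable.snd.comp (Computable.snd.comp hq')
    have hGc : Computable fun p : (α × ℕ) × (ℕ × ℕ) =>
        G (p.1.1, (q p.2.1).1, (q p.2.1).2.1) (q p.2.1).2.2 :=
      hG.comp (ha.pair (hm'.pair hn')) hu'
    have hGi : Computable fun p : (α × ℕ) × (ℕ × ℕ) =>
        (G (p.1.1, (q p.2.1).1, (q p.2.1).2.1) (q p.2.1).2.2).isSome :=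
      Primrec.option_isSome.to_comp.comp hGc
    have hBc : Computable fun p : (α × ℕ) × (ℕ × ℕ) => B p.1.1 p.1.2 p.2.1 :=
      Computable.cond hGi
        (computable_div (computable_mul (computable_pow (Computable.const 2) ht) hm')
        (Computable.succ.comp hn')) (Computable.const 0)
    exact Computable.nat_rec Computable.snd (Computable.const 0)
      (h := fun p r => max r.2 (B p.1 p.2 r.1))
      (computable_max (Computable.snd.comp Computable.snd) hBc)
  · rcases lt_or_ge y 0 with hy0 | hy0
    · exact ⟨0, hy0.trans_le (by positivity)⟩
    · obtain ⟨r, hyr, hrf⟩ := exists_rat_btwn hy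
      have hr0 : 0 < r := by exact_mod_cast hy0.trans_lt hyr
      -- The coded denominator is `r.den - 1` because `IsEnumerable` divides by the successor.
      have hr : ((r.num.toNat : ℝ) / (((r.den - 1 : ℕ) : ℝ) + 1)) = r := by
        have h1 : ((r.num.toNat : ℤ)) = r.num := Int.toNat_of_nonneg (Rat.num_pos.2 hr0).le
        have h2 : ((r.den - 1 : ℕ) : ℝ) + 1 = r.den := by
          exact_mod_cast Nat.succ_pred_eq_of_pos r.den_pos
        rw [h2]
        conv_rhs => rw [← Rat.num_div_den r]
        push_cast
        congr 1
        exact_mod_cast h1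
      obtain ⟨t, ht⟩ := (hG' (a, r.num.toNat, r.den - 1)).1 (by simpa only [hr] using hrf)
      obtain ⟨w, hw⟩ := hqs (r.num.toNat, r.den - 1, t)
      have hlim : Tendsto (fun n => (B a n w : ℝ) / 2 ^ n) atTop (𝓝 r) := by
        simp only [B, hw, ht, Option.isSome_some, cond_true]
        refine tendsto_dyadic_natDiv (tendsto_const_nhds.congr fun n => ?_)
        rw [← hr]
        push_cast
        field_simp
      obtain ⟨n, hn, hnw⟩ := ((hlim.eventually_const_lt hyr).and (eventually_gt_atTop w)).exists
      refine ⟨n, hn.trans_le ?_⟩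
      have := hSB a n n w hnw
      gcongr

end LowerSemicomputable
/-! ### Kraft's inequality and sums over halting programs -/

/-- The first words of two factorizations of one string are both prefixes of it, hence comparable,
hence equal; they cancel and induction applies. -/
theorem uniquelyDecodable_of_prefixFree {α : Type*} {S : Set (List α)} (hnil : [] ∉ S)
    (h : ∀ p ∈ S, ∀ q ∈ S, p <+: q → p = q) : InformationTheory.UniquelyDecodable S := by
  intro L₁
  induction L₁ with
  | nil =>
    intro L₂ _ h2 he
    cases L₂ with
    | nil => rfl
    | cons b L₂ =>
      simp only [List.flatten_nil, List.flatten_cons] at he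
      have hb := h2 b List.mem_cons_self
      rw [(List.append_eq_nil_iff.1 he.symm).1] at hb
      exact absurd hb hnil
  | cons a L₁ ih =>
    intro L₂ h1 h2 he
    have ha := h1 a List.mem_cons_self
    cases L₂ with
    | nil =>
      simp only [List.flatten_nil, List.flatten_cons] at he
      rw [(List.append_eq_nil_iff.1 he).1] at ha
      exact absurd ha hnil
    | cons b L₂ =>
      have hb := h2 b List.mem_cons_self
      simp only [List.flatten_cons] at he
      have hab : a = b := by
        rcases List.prefix_or_prefix_of_prefix (List.prefix_append a L₁.flatten)
          (he ▸ List.prefix_append b L₂.flatten) with hp | hp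
        · exact h a ha b hb hp
        · exact (h b hb a ha hp).symm
      subst hab
      rw [ih L₂ (fun w hw => h1 w (List.mem_cons_of_mem _ hw))
        (fun w hw => h2 w (List.mem_cons_of_mem _ hw)) (List.append_cancel_left he)]

theorem sum_half_pow_length_le_one {S : Finset (List Bool)}
    (h : ∀ p ∈ S, ∀ q ∈ S, p <+: q → p = q) : ∑ p ∈ S, (2 : ℝ)⁻¹ ^ p.length ≤ 1 := by
  -- A uniquely decodable code cannot contain the empty word; a prefix-free set that does is just
  -- that word, of weight 1.
  by_cases hnil : [] ∈ S
  · have : S ⊆ {[]} := fun p hp =>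
      Finset.mem_singleton.2 (h [] hnil p hp List.nil_prefix).symm
    exact (Finset.sum_le_sum_of_subset_of_nonneg this fun _ _ _ => by positivity).trans (by simp)
  · simpa using InformationTheory.kraft_mcmillan_inequality
      (uniquelyDecodable_of_prefixFree (S := (S : Set (List Bool))) (by simpa using hnil)
        (by simpa using h))

/-- The sum of `2 ^ (-ℓ(p)) * F (U (p, x))` over all halting programs `p`. -/
noncomputable def haltSum {X : Type*} (U : List Bool × List X →. ℕ) (x : List X) (F : ℕ → ℝ) : ℝ :=
  ∑' p : List Bool, (2 : ℝ)⁻¹ ^ p.length * partVal (U (p, x)) F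

section haltSum

variable {X : Type*} [Primcodable X] {U : List Bool × List X →. ℕ} {x : List X} {F G : ℕ → ℝ}

theorem IsPrefixMachine.sum_haltSum_le (hU : IsPrefixMachine U) (h1 : ∀ n, F n ≤ 1)
    (s : Finset (List Bool)) :
    ∑ p ∈ s, (2 : ℝ)⁻¹ ^ p.length * partVal (U (p, x)) F ≤ 1 := by
  classical
  calc ∑ p ∈ s, (2 : ℝ)⁻¹ ^ p.length * partVal (U (p, x)) F
      ≤ ∑ p ∈ s, if (U (p, x)).Dom then (2 : ℝ)⁻¹ ^ p.length else 0 := by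
        refine Finset.sum_le_sum fun p _ => ?_
        split_ifs with hd
        · rw [partVal_of_mem (Part.get_mem hd)]
          exact mul_le_of_le_one_right (by positivity) (h1 _)
        · rw [partVal_of_not_dom hd, mul_zero]
    _ = ∑ p ∈ s with (U (p, x)).Dom, (2 : ℝ)⁻¹ ^ p.length := (Finset.sum_filter _ _).symm
    _ ≤ 1 := by
        refine sum_half_pow_length_le_one fun p hp q hq hpq => ?_
        exact hU.2 x p q (Finset.mem_filter.1 hp).2 (Finset.mem_filter.1 hq).2 hpq

theorem IsPrefixMachine.summable_haltSum (hU : IsPrefixMachine U) (h0 : ∀ n, 0 ≤ F n)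
    (h1 : ∀ n, F n ≤ 1) :
    Summable fun p : List Bool => (2 : ℝ)⁻¹ ^ p.length * partVal (U (p, x)) F :=
  summable_of_sum_le (fun _ => mul_nonneg (by positivity) (partVal_nonneg h0))
    (hU.sum_haltSum_le h1)

omit [Primcodable X] in
theorem haltSum_nonneg (h0 : ∀ n, 0 ≤ F n) : 0 ≤ haltSum U x F :=
  tsum_nonneg fun _ => mul_nonneg (by positivity) (partVal_nonneg h0)

theorem IsPrefixMachine.haltSum_le_one (hU : IsPrefixMachine U) (h0 : ∀ n, 0 ≤ F n)
    (h1 : ∀ n, F n ≤ 1) : haltSum U x F ≤ 1 :=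
  (hU.summable_haltSum h0 h1).tsum_le_of_sum_le (hU.sum_haltSum_le h1)

theorem IsPrefixMachine.haltSum_mono (hU : IsPrefixMachine U) (h0 : ∀ n, 0 ≤ F n)
    (hFG : ∀ n, F n ≤ G n) (h1 : ∀ n, G n ≤ 1) : haltSum U x F ≤ haltSum U x G :=
  Summable.tsum_le_tsum (fun _ => mul_le_mul_of_nonneg_left (partVal_mono hFG) (by positivity))
    (hU.summable_haltSum h0 fun n => (hFG n).trans (h1 n))
    (hU.summable_haltSum (fun n => (h0 n).trans (hFG n)) h1)

theorem IsPrefixMachine.haltSum_sum (hU : IsPrefixMachine U) {ι : Type*} (s : Finset ι)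
    {F : ι → ℕ → ℝ} (h0 : ∀ i n, 0 ≤ F i n) (h1 : ∀ i n, F i n ≤ 1) :
    haltSum U x (fun n => ∑ i ∈ s, F i n) = ∑ i ∈ s, haltSum U x (F i) := by
  simp only [haltSum, partVal_sum, Finset.mul_sum]
  exact Summable.tsum_finsetSum fun i _ => hU.summable_haltSum (h0 i) (h1 i)

theorem IsPrefixMachine.le_haltSum (hU : IsPrefixMachine U) (h0 : ∀ n, 0 ≤ F n)
    (h1 : ∀ n, F n ≤ 1) {p : List Bool} {n : ℕ} (hp : n ∈ U (p, x)) :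
    (2 : ℝ)⁻¹ ^ p.length * F n ≤ haltSum U x F := by
  rw [← partVal_of_mem (F := F) hp]
  exact (hU.summable_haltSum h0 h1).le_tsum p
    fun _ _ => mul_nonneg (by positivity) (partVal_nonneg h0)

/-- Weighting by all halting programs, instead of by 2^{-K(n)}, gives a series whose terms are
visibly lower semicomputable, with no need to approximate K. Kraft's inequality makes it converge.
-/
theorem IsPrefixMachine.lowerSemicomputable_haltSum (hU : IsPrefixMachine U) {α : Type*}
    [Primcodable α] {F : α × ℕ → ℝ} (hF : LowerSemicomputable F) (h1 : ∀ z, F z ≤ 1)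
    {k : α → List X} (hk : Computable k) :
    LowerSemicomputable fun a => haltSum U (k a) fun n => F (a, n) := by
  have hpow : LowerSemicomputable fun z : α × List Bool => (((2 ^ z.2.length : ℕ) : ℝ))⁻¹ :=
    LowerSemicomputable.inv_natCast (k := fun z : α × List Bool => 2 ^ z.2.length)
      (computable_pow (Computable.const 2) (Computable.list_length.comp Computable.snd))
  have hF' : LowerSemicomputable fun w : (α × List Bool) × ℕ => F (w.1.1, w.2) :=
    hF.comp ((Computable.fst.comp Computable.fst).pair Computable.snd)
  have hU' : Partrec fun z : α × List Bool => U (z.2, k z.1) :=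
    hU.1.comp (Computable.snd.pair (hk.comp Computable.fst))
  have hprod : LowerSemicomputable fun z : α × List Bool =>
      (2 : ℝ)⁻¹ ^ z.2.length * partVal (U (z.2, k z.1)) fun n => F (z.1, n) :=
    (hpow.of_eq fun z => by simp).mul (hF'.partVal hU')
  have hs : ∀ a, Summable fun p : List Bool =>
      (2 : ℝ)⁻¹ ^ p.length * partVal (U (p, k a)) fun n => F (a, n) :=
    fun a => hU.summable_haltSum (fun n => hF.nonneg (a, n)) fun n => h1 (a, n)
  exact (hprod.tsum hs).of_eq fun a => rfl

end haltSum

/-! ### Complexities are attained -/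

section Complexity

variable {X : Type*} [Primcodable X] {U : List Bool × List X →. ℕ}

theorem IsUniversalPrefixMachine.exists_program (hU : IsUniversalPrefixMachine U) (n : ℕ)
    (x : List X) : ∃ p : List Bool, n ∈ U (p, x) := by
  -- the machine that outputs `n` on the empty program and diverges otherwise
  have hT : IsPrefixMachine fun z : List Bool × List X =>
      ((if z.1.length = 0 then some n else none : Option ℕ) : Part ℕ) := by
    refine ⟨Computable.ofOption ?_, fun x p q hp hq _ => ?_⟩
    · refine (Computable.cond (computable_decide_eq (Computable.list_length.comp Computable.fst)
        (Computable.const 0)) (Computable.const (some n)) (Computable.const none)).of_eq ?_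
      intro z
      by_cases h : z.1.length = 0 <;> simp [h]
    · have key : ∀ p : List Bool,
          ((if p.length = 0 then some n else none : Option ℕ) : Part ℕ).Dom → p = [] := by
        intro p hp
        by_contra hne
        rw [if_neg (by simpa using hne)] at hp
        exact hp
      rw [key p hp, key q hq]
  obtain ⟨c, hc⟩ := hU.2 _ hT
  obtain ⟨q, hq, -⟩ := hc [] x n (by simp)
  exact ⟨q, hq⟩

theorem IsUniversalPrefixMachine.exists_condK (hU : IsUniversalPrefixMachine U) (n : ℕ)
    (x : List X) : ∃ p : List Bool, n ∈ U (p, x) ∧ p.length = condK U n x := by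
  obtain ⟨p, hp⟩ := hU.exists_program n x
  exact Nat.sInf_mem (s := {k | ∃ p : List Bool, n ∈ U (p, x) ∧ p.length = k}) ⟨_, p, hp, rfl⟩

theorem IsUniversalPrefixMachine.exists_measureK (hU : IsUniversalPrefixMachine U)
    {ν : ℕ → List X → ℝ} {μ : List X → ℝ} (hμ : ∃ i, ν i = μ) (x : List X) :
    ∃ (i : ℕ) (p : List Bool), ν i = μ ∧ i ∈ U (p, x) ∧ p.length = measureK U ν μ x := by
  obtain ⟨i, hi⟩ := hμ
  obtain ⟨p, hp⟩ := hU.exists_program i x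
  exact Nat.sInf_mem (s := {k | ∃ (i : ℕ) (p : List Bool), ν i = μ ∧ i ∈ U (p, x) ∧ p.length = k})
    ⟨_, i, p, hi, hp, rfl⟩

end Complexity

/-! ### Sums over strings of a given length -/

section Strings

variable {X : Type*} [Fintype X]

theorem sum_ofFn_succ (f : List X → ℝ) (n : ℕ) :
    ∑ y : Fin (n + 1) → X, f (List.ofFn y) =
      ∑ y : Fin n → X, ∑ a, f (List.ofFn y ++ [a]) := by
  rw [← (Fin.snocEquiv fun _ => X).sum_comp, Fintype.sum_prod_type, Finset.sum_comm]
  refine Finset.sum_congr rfl fun y _ => Finset.sum_congr rfl fun a _ => ?_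
  rw [List.ofFn_succ']
  simp [Fin.snocEquiv]

theorem sum_ofFn_add (f : List X → ℝ) (l n : ℕ) :
    ∑ y : Fin (l + n) → X, f (List.ofFn y) =
      ∑ x : Fin l → X, ∑ y : Fin n → X, f (List.ofFn x ++ List.ofFn y) := by
  induction n generalizing f with
  | zero => simp
  | succ n ih =>
    rw [← add_assoc, sum_ofFn_succ, ih fun x => ∑ a, f (x ++ [a])]
    refine Finset.sum_congr rfl fun x _ => ?_
    rw [sum_ofFn_succ fun y => f (List.ofFn x ++ y)]
    simp

omit [Fintype X] in
theorem ofFn_injective {n : ℕ} : Function.Injective (List.ofFn : (Fin n → X) → List X) :=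
  List.ofFn_injective

omit [Fintype X] in
theorem notMem_range_ofFn {n : ℕ} {x : List X}
    (hx : x ∉ Set.range (List.ofFn : (Fin n → X) → List X)) : x.length ≠ n := by
  rintro rfl
  exact hx ⟨x.get, List.ofFn_get x⟩

theorem summable_ite_length (f : List X → ℝ) (n : ℕ) :
    Summable fun x : List X => if x.length = n then f x else 0 := by
  refine (ofFn_injective.summable_iff fun x hx => ?_).1
    (Summable.of_finite (β := Fin n → X))
  rw [if_neg (notMem_range_ofFn hx)]

theorem tsum_ite_length (f : List X → ℝ) (n : ℕ) :
    ∑' x : List X, (if x.length = n then f x else 0) = ∑ y : Fin n → X, f (List.ofFn y) := by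
  rw [← (ofFn_injective (n := n)).tsum_eq (Function.support_subset_iff'.2 fun x hx => by
    rw [if_neg (notMem_range_ofFn hx)]), tsum_fintype]
  simp

end Strings
/-! ### Semimeasures -/

section Semimeasure

variable {X : Type*} [Fintype X] {ρ : List X → ℝ}

theorem IsMeasure.isSemimeasure (h : IsMeasure ρ) : IsSemimeasure ρ :=
  ⟨h.1, h.2.1.le, fun x => (h.2.2 x).le⟩

theorem IsMeasure.nonempty (h : IsMeasure ρ) : Nonempty X := by
  by_contra hX
  rw [not_nonempty_iff] at hX
  have := h.2.2 []
  rw [h.2.1] at this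
  simp at this

theorem IsSemimeasure.sum_append_le (h : IsSemimeasure ρ) (x : List X) (n : ℕ) :
    ∑ y : Fin n → X, ρ (x ++ List.ofFn y) ≤ ρ x := by
  induction n with
  | zero => simp
  | succ n ih =>
    rw [sum_ofFn_succ fun y => ρ (x ++ y)]
    refine le_trans (Finset.sum_le_sum fun y _ => ?_) ih
    simpa using h.2.2 (x ++ List.ofFn y)

theorem IsSemimeasure.append_le (h : IsSemimeasure ρ) (x y : List X) : ρ (x ++ y) ≤ ρ x := by
  refine le_trans ?_ (h.sum_append_le x y.length)
  have := Finset.single_le_sum (f := fun z : Fin y.length → X => ρ (x ++ List.ofFn z))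
    (fun z _ => h.1 _) (Finset.mem_univ y.get)
  simpa using this

theorem IsSemimeasure.le_one (h : IsSemimeasure ρ) (x : List X) : ρ x ≤ 1 :=
  (h.append_le [] x).trans h.2.1

theorem IsMeasure.sum_append (h : IsMeasure ρ) (x : List X) (n : ℕ) :
    ∑ y : Fin n → X, ρ (x ++ List.ofFn y) = ρ x := by
  induction n with
  | zero => simp
  | succ n ih =>
    rw [sum_ofFn_succ fun y => ρ (x ++ y), ← ih]
    refine Finset.sum_congr rfl fun y _ => ?_
    simpa using h.2.2 (x ++ List.ofFn y)

/-- The uniform measure. -/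
noncomputable def uniform (x : List X) : ℝ := (Fintype.card X : ℝ)⁻¹ ^ x.length

theorem uniform_append_singleton (x : List X) (a : X) :
    uniform (x ++ [a]) = uniform x * (Fintype.card X : ℝ)⁻¹ := by
  simp [uniform, pow_succ]

theorem isMeasure_uniform [Nonempty X] : IsMeasure (uniform : List X → ℝ) := by
  refine ⟨fun x => by unfold uniform; positivity, by simp [uniform], fun x => ?_⟩
  simp only [uniform_append_singleton, Finset.sum_const, Finset.card_univ, nsmul_eq_mul]
  field_simp

theorem uniform_pos [Nonempty X] (x : List X) : 0 < uniform x := by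
  unfold uniform
  positivity

theorem lowerSemicomputable_uniform [Primcodable X] :
    LowerSemicomputable (uniform : List X → ℝ) := by
  refine (LowerSemicomputable.inv_natCast (k := fun x : List X => Fintype.card X ^ x.length)
    (computable_pow (Computable.const _) Computable.list_length)).of_eq fun x => ?_
  simp [uniform]

open Classical in
/-- The mass of the strings of the same length as `x` and different from `x`. -/
noncomputable def otherMass (ρ : List X → ℝ) (x : List X) : ℝ :=
  ∑' y : List X, if y.length = x.length then (if y = x then 0 else ρ y) else 0

theorem otherMass_add (ρ : List X → ℝ) (x : List X) :
    otherMass ρ x + ρ x = ∑ y : Fin x.length → X, ρ (List.ofFn y) := by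
  classical
  have hx : ∑ y : Fin x.length → X, (if List.ofFn y = x then ρ x else 0) = ρ x := by
    have : ∀ y : Fin x.length → X, List.ofFn y = x ↔ y = x.get := fun y =>
      ⟨fun h => ofFn_injective (h.trans (List.ofFn_get x).symm), fun h => h ▸ List.ofFn_get x⟩
    simp only [this, Finset.sum_ite_eq', Finset.mem_univ, if_true]
  unfold otherMass
  rw [tsum_ite_length (fun y => if y = x then 0 else ρ y)]
  rw [← hx, ← Finset.sum_add_distrib]
  refine Finset.sum_congr rfl fun y _ => ?_
  split_ifs with h
  · rw [zero_add, congrArg ρ h]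
  · rw [add_zero]

theorem IsSemimeasure.le_one_sub_otherMass (h : IsSemimeasure ρ) (x : List X) :
    ρ x ≤ 1 - otherMass ρ x := by
  have h1 := h.sum_append_le [] x.length
  have h2 := otherMass_add ρ x
  have h3 := h.2.1
  simp only [List.nil_append] at h1
  linarith

/-- The masses of the strings of one length add up to exactly 1 for a measure; for a semimeasure
they add up to at most 1, and only an inequality remains. -/
theorem IsMeasure.one_sub_otherMass (h : IsMeasure ρ) (x : List X) :
    1 - otherMass ρ x = ρ x := by
  have h1 := h.sum_append [] x.length
  have h2 := otherMass_add ρ x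
  have h3 := h.2.1
  simp only [List.nil_append] at h1
  linarith

/-- A version of the conditional probability `ρ(y|x)` that is lower semicomputable and bounded by
one for every enumerable semimeasure `ρ`. -/
noncomputable def lowerCond (ρ : List X → ℝ) (x y : List X) : ℝ :=
  ρ (x ++ y) / (1 - otherMass ρ x)

theorem IsSemimeasure.lowerCond_nonneg (h : IsSemimeasure ρ) (x y : List X) :
    0 ≤ lowerCond ρ x y :=
  div_nonneg (h.1 _) ((h.1 x).trans (h.le_one_sub_otherMass x))

theorem IsSemimeasure.lowerCond_le_one (h : IsSemimeasure ρ) (x y : List X) :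
    lowerCond ρ x y ≤ 1 :=
  div_le_one_of_le₀ ((h.append_le x y).trans (h.le_one_sub_otherMass x))
    ((h.1 x).trans (h.le_one_sub_otherMass x))

theorem IsSemimeasure.sum_lowerCond_le (h : IsSemimeasure ρ) (x y : List X) :
    ∑ a, lowerCond ρ x (y ++ [a]) ≤ lowerCond ρ x y := by
  unfold lowerCond
  rw [← Finset.sum_div]
  refine div_le_div_of_nonneg_right ?_ ((h.1 x).trans (h.le_one_sub_otherMass x))
  simpa using h.2.2 (x ++ y)

theorem IsMeasure.lowerCond_eq (h : IsMeasure ρ) {x : List X} (hx : ρ x ≠ 0) (y : List X) :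
    lowerCond ρ x y = condProb ρ x y := by
  rw [lowerCond, condProb, if_neg hx, h.one_sub_otherMass]

/-- The function that follows `ρ` for `l` symbols and then the conditional probability `g`. -/
noncomputable def splice (ρ : List X → ℝ) (g : List X → List X → ℝ) (l : ℕ) (z : List X) : ℝ :=
  bif decide (l < z.length) then ρ (z.take l) * g (z.take l) (z.drop l) else ρ z

omit [Fintype X] in
theorem splice_append (ρ : List X → ℝ) {g : List X → List X → ℝ} {x y : List X} (hy : y ≠ []) :
    splice ρ g x.length (x ++ y) = ρ x * g x y := by
  have : x.length < (x ++ y).length := by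
    simpa using List.length_pos_of_ne_nil hy
  simp only [splice, this, decide_true, cond_true, List.take_left, List.drop_left]

omit [Fintype X] in
theorem splice_of_le (ρ : List X → ℝ) {g : List X → List X → ℝ} {l : ℕ} {z : List X}
    (h : z.length ≤ l) : splice ρ g l z = ρ z := by
  simp [splice, not_lt.2 h]

theorem IsSemimeasure.splice (h : IsSemimeasure ρ) {g : List X → List X → ℝ}
    (hg0 : ∀ x y, 0 ≤ g x y) (hg1 : ∀ x, g x [] ≤ 1)
    (hg : ∀ x y, ∑ a, g x (y ++ [a]) ≤ g x y) (l : ℕ) : IsSemimeasure (splice ρ g l) := by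
  refine ⟨fun z => ?_, ?_, fun z => ?_⟩
  · unfold FuturePrediction.splice
    cases decide (l < z.length)
    exacts [h.1 _, mul_nonneg (h.1 _) (hg0 _ _)]
  · rw [splice_of_le _ (by simp)]
    exact h.2.1
  · rcases lt_or_ge z.length l with hl | hl
    · rw [splice_of_le _ hl.le]
      refine le_trans (Finset.sum_le_sum fun a _ => ?_) (h.2.2 z)
      rw [splice_of_le _ (by simpa using hl)]
    · obtain ⟨x, y, rfl, rfl⟩ : ∃ x y : List X, z = x ++ y ∧ l = x.length :=
        ⟨z.take l, z.drop l, (List.take_append_drop l z).symm, by simpa using hl⟩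
      have h1 : ∑ a, FuturePrediction.splice ρ g x.length (x ++ y ++ [a]) ≤ ρ x * g x y := by
        simp only [List.append_assoc]
        have : ∀ a, FuturePrediction.splice ρ g x.length (x ++ (y ++ [a])) =
          ρ x * g x (y ++ [a]) := fun a => splice_append ρ (by simp)
        simp only [this, ← Finset.mul_sum]
        exact mul_le_mul_of_nonneg_left (hg x y) (h.1 x)
      refine h1.trans ?_
      -- At the junction z = x the splice has the value ρ(x), not ρ(x) g(x, ε); this is where g(x,
      -- ε) ≤ 1 is used.
      rcases eq_or_ne y [] with rfl | hy
      · rw [splice_of_le _ (by simp)]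
        simpa using mul_le_mul_of_nonneg_left (hg1 x) (h.1 x)
      · rw [splice_append ρ hy]

end Semimeasure

/-! ### The dominating property of the universal mixture -/

section Mixture

variable {X : Type*} [Fintype X] [Primcodable X] {U : List Bool × List X →. ℕ}
  {ν : ℕ → List X → ℝ}

theorem IsPrefixMachine.isSemimeasure_haltSum (hU : IsPrefixMachine U)
    (hν : ∀ i, IsSemimeasure (ν i)) (x : List X) :
    IsSemimeasure fun z => haltSum U x fun i => ν i z := by
  refine ⟨fun z => haltSum_nonneg fun i => (hν i).1 z,
    hU.haltSum_le_one (fun i => (hν i).1 _) fun i => (hν i).le_one _, fun z => ?_⟩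
  rw [← hU.haltSum_sum _ (fun a i => (hν i).1 _) fun a i => (hν i).le_one _]
  exact hU.haltSum_mono (fun i => Finset.sum_nonneg fun a _ => (hν i).1 _)
    (fun i => (hν i).2.2 z) fun i => (hν i).le_one z

/-- The prediction of the continuation `y` of `x` by a mixture of the uniform measure and all
semimeasures, weighted by their complexity given `x`. -/
noncomputable def predictive (U : List Bool × List X →. ℕ) (ν : ℕ → List X → ℝ)
    (x y : List X) : ℝ :=
  2⁻¹ * uniform y + 2⁻¹ * haltSum U x fun i => lowerCond (ν i) x y

/-- The mixture of all the semimeasures which are universal up to some time and predict by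
`predictive` after it. -/
noncomputable def splicedMixture (U : List Bool × List X →. ℕ) (ν : ℕ → List X → ℝ)
    (z : List X) : ℝ :=
  haltSum U [] fun l => splice (fun x => haltSum U [] fun i => ν i x) (predictive U ν) l z

section

variable (hU : IsPrefixMachine U) (hν : ∀ i, IsSemimeasure (ν i))
include hU hν

theorem isSemimeasure_splice_predictive [Nonempty X] (l : ℕ) :
    IsSemimeasure (splice (fun x => haltSum U [] fun i => ν i x) (predictive U ν) l) := by
  have hun := isMeasure_uniform (X := X)
  have h0 : ∀ x y, 0 ≤ haltSum U x fun i => lowerCond (ν i) x y := fun x y =>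
    haltSum_nonneg fun i => (hν i).lowerCond_nonneg x y
  refine (hU.isSemimeasure_haltSum hν []).splice (fun x y => ?_) (fun x => ?_) (fun x y => ?_) l
  · have := hun.1 y
    have := h0 x y
    unfold predictive
    positivity
  · have h1 : (haltSum U x fun i => lowerCond (ν i) x []) ≤ 1 :=
      hU.haltSum_le_one (fun i => (hν i).lowerCond_nonneg x _) fun i => (hν i).lowerCond_le_one x _
    have h2 := hun.2.1
    unfold predictive
    linarith
  · have h1 : ∑ a, (haltSum U x fun i => lowerCond (ν i) x (y ++ [a])) ≤
        haltSum U x fun i => lowerCond (ν i) x y := by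
      rw [← hU.haltSum_sum _ (fun a i => (hν i).lowerCond_nonneg x _)
        fun a i => (hν i).lowerCond_le_one x _]
      exact hU.haltSum_mono (fun i => Finset.sum_nonneg fun a _ => (hν i).lowerCond_nonneg x _)
        (fun i => (hν i).sum_lowerCond_le x y) fun i => (hν i).lowerCond_le_one x y
    have h2 := hun.2.2 y
    unfold predictive
    rw [Finset.sum_add_distrib, ← Finset.mul_sum, ← Finset.mul_sum, h2]
    linarith

theorem isSemimeasure_splicedMixture [Nonempty X] : IsSemimeasure (splicedMixture U ν) :=
  hU.isSemimeasure_haltSum (fun l => isSemimeasure_splice_predictive hU hν l) []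

variable (he : LowerSemicomputable fun z : ℕ × List X => ν z.1 z.2)
include he

theorem lowerSemicomputable_mixture :
    LowerSemicomputable fun x : List X => haltSum U [] fun i => ν i x :=
  hU.lowerSemicomputable_haltSum (F := fun z : List X × ℕ => ν z.2 z.1)
    (he.comp (Computable.snd.pair Computable.fst)) (fun z => (hν z.2).le_one z.1)
    (Computable.const [])

omit hU hν in
-- The finite sum over strings of equal length is a series over all strings with a decidable cutoff,
-- so the closure under series applies.
theorem lowerSemicomputable_otherMass :
    LowerSemicomputable fun z : ℕ × List X => otherMass (ν z.1) z.2 := by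
  classical
  have h1 : Computable fun w : (ℕ × List X) × List X => decide (w.2.length = w.1.2.length) :=
    computable_decide_eq (Computable.list_length.comp Computable.snd)
      (Computable.list_length.comp (Computable.snd.comp Computable.fst))
  have h2 : Computable fun w : (ℕ × List X) × List X => decide (w.2 = w.1.2) :=
    computable_decide_eq Computable.snd (Computable.snd.comp Computable.fst)
  have h3 : LowerSemicomputable fun w : (ℕ × List X) × List X => ν w.1.1 w.2 :=
    he.comp ((Computable.fst.comp Computable.fst).pair Computable.snd)
  have h4 := LowerSemicomputable.cond h1
    (LowerSemicomputable.cond h2 LowerSemicomputable.zero h3) LowerSemicomputable.zero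
  have h5 : LowerSemicomputable fun w : (ℕ × List X) × List X =>
      if w.2.length = w.1.2.length then (if w.2 = w.1.2 then 0 else ν w.1.1 w.2) else 0 :=
    h4.of_eq fun w => by simp only [Bool.cond_decide]
  exact h5.tsum fun a => summable_ite_length (fun y => if y = a.2 then 0 else ν a.1 y) a.2.length

omit hU in
theorem lowerSemicomputable_lowerCond :
    LowerSemicomputable fun z : (List X × List X) × ℕ => lowerCond (ν z.2) z.1.1 z.1.2 := by
  have hx : Computable fun z : (List X × List X) × ℕ => z.1.1 :=
    Computable.fst.comp Computable.fst
  have hy : Computable fun z : (List X × List X) × ℕ => z.1.2 :=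
    Computable.snd.comp Computable.fst
  have h1 : LowerSemicomputable fun z : (List X × List X) × ℕ => ν z.2 (z.1.1 ++ z.1.2) :=
    he.comp (Computable.snd.pair (Computable.list_append.comp hx hy))
  have h2 : LowerSemicomputable fun z : (List X × List X) × ℕ => otherMass (ν z.2) z.1.1 :=
    (lowerSemicomputable_otherMass he).comp (Computable.snd.pair hx)
  exact h1.div_one_sub h2 fun z =>
    ((hν _).append_le _ _).trans ((hν _).le_one_sub_otherMass _)

theorem lowerSemicomputable_predictive :
    LowerSemicomputable fun z : List X × List X => predictive U ν z.1 z.2 := by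
  have h1 : LowerSemicomputable fun _ : List X × List X => (2 : ℝ)⁻¹ :=
    (LowerSemicomputable.inv_natCast (Computable.const 2)).of_eq fun _ => by norm_num
  have h2 : LowerSemicomputable fun z : List X × List X =>
      haltSum U z.1 fun i => lowerCond (ν i) z.1 z.2 :=
    hU.lowerSemicomputable_haltSum (lowerSemicomputable_lowerCond hν he)
      (fun z => (hν _).lowerCond_le_one _ _) Computable.fst
  exact (h1.mul (lowerSemicomputable_uniform.comp Computable.snd)).add (h1.mul h2)

theorem lowerSemicomputable_splicedMixture [Nonempty X] :
    LowerSemicomputable (splicedMixture U ν) := by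
  have ht : Computable fun z : List X × ℕ => z.1.take z.2 :=
    Primrec.list_take.to_comp.comp Computable.snd Computable.fst
  have hd : Computable fun z : List X × ℕ => z.1.drop z.2 :=
    Primrec.list_drop.to_comp.comp Computable.snd Computable.fst
  have hM := lowerSemicomputable_mixture hU hν he
  have h1 : LowerSemicomputable fun z : List X × ℕ =>
      splice (fun x => haltSum U [] fun i => ν i x) (predictive U ν) z.2 z.1 :=
    LowerSemicomputable.cond
      (computable_lt Computable.snd (Computable.list_length.comp Computable.fst))
      ((hM.comp ht).mul ((lowerSemicomputable_predictive hU hν he).comp (ht.pair hd)))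
      (hM.comp Computable.fst)
  exact hU.lowerSemicomputable_haltSum h1
    (fun z => (isSemimeasure_splice_predictive hU hν z.2).le_one z.1) (Computable.const [])

end

end Mixture
-- Lower bounds for the Solomonoff prior.
section Domination

variable {X : Type*} [Fintype X] [Primcodable X] {U : List Bool × List X →. ℕ}
  {ν : ℕ → List X → ℝ}

section

variable (hU : IsUniversalPrefixMachine U) (hν : ∀ i, IsSemimeasure (ν i))
include hU hν

/-- Shortest programs of different numbers are different, so the prior is a subseries of the sum
over all halting programs. -/
theorem summable_solomonoff_and_le (x : List X) :
    (Summable fun i => (2 : ℝ)⁻¹ ^ prefixK U i * ν i x) ∧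
      solomonoff U ν x ≤ haltSum U [] fun i => ν i x := by
  choose p hp hpK using fun i => hU.exists_condK i []
  have hinj : Function.Injective p := fun i j hij =>
    Part.mem_unique (hp i) (hij ▸ hp j)
  have hterm : ∀ i, (2 : ℝ)⁻¹ ^ prefixK U i * ν i x =
      (2 : ℝ)⁻¹ ^ (p i).length * partVal (U (p i, [])) fun i => ν i x := by
    intro i
    rw [partVal_of_mem (hp i), hpK, prefixK]
  have hs := hU.1.summable_haltSum (x := []) (fun i => (hν i).1 x) fun i => (hν i).le_one x
  have h0 : ∀ q : List Bool, 0 ≤ (2 : ℝ)⁻¹ ^ q.length * partVal (U (q, [])) fun i => ν i x :=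
    fun q => mul_nonneg (by positivity) (partVal_nonneg fun i => (hν i).1 x)
  unfold solomonoff
  simp only [hterm]
  exact ⟨hs.comp_injective hinj, tsum_comp_le_tsum_of_inj hs h0 hinj⟩

theorem le_solomonoff (i : ℕ) (x : List X) :
    (2 : ℝ)⁻¹ ^ prefixK U i * ν i x ≤ solomonoff U ν x :=
  (summable_solomonoff_and_le hU hν x).1.le_tsum i
    fun j _ => mul_nonneg (by positivity) ((hν j).1 x)

theorem isSemimeasure_solomonoff : IsSemimeasure (solomonoff U ν) := by
  have hs := fun x => (summable_solomonoff_and_le hU hν x).1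
  refine ⟨fun x => tsum_nonneg fun i => mul_nonneg (by positivity) ((hν i).1 x), ?_, fun x => ?_⟩
  · exact (summable_solomonoff_and_le hU hν []).2.trans
      (hU.1.isSemimeasure_haltSum hν []).2.1
  · unfold solomonoff
    rw [← Summable.tsum_finsetSum fun a _ => hs _]
    refine Summable.tsum_le_tsum (fun i => ?_) (summable_sum fun a _ => hs _) (hs x)
    rw [← Finset.mul_sum]
    exact mul_le_mul_of_nonneg_left ((hν i).2.2 x) (by positivity)

end

variable (hU : IsUniversalPrefixMachine U) (hν : IsEffectiveEnumeration ν)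
include hU hν

/-- The uniform measure is positive everywhere and occurs in the enumeration. -/
theorem solomonoff_pos [Nonempty X] (x : List X) : 0 < solomonoff U ν x := by
  obtain ⟨i, hi⟩ := hν.2.2 uniform isMeasure_uniform.isSemimeasure
    lowerSemicomputable_uniform.isEnumerable
  refine lt_of_lt_of_le ?_ (le_solomonoff hU hν.1 i x)
  rw [hi]
  have := uniform_pos x
  positivity

theorem exists_solomonoff_dominates [Nonempty X] :
    ∃ c : ℕ, ∀ μ : List X → ℝ, IsMeasure μ → IsEnumerable μ → ∀ x y : List X,
      (2 : ℝ)⁻¹ ^ (c + prefixK U x.length + measureK U ν μ x) *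
        (solomonoff U ν x * condProb μ x y) ≤ solomonoff U ν (x ++ y) := by
  have he : LowerSemicomputable fun z : ℕ × List X => ν z.1 z.2 :=
    LowerSemicomputable.of_isEnumerable hν.2.1 fun z => (hν.1 _).1 _
  obtain ⟨j, hj⟩ := hν.2.2 _ (isSemimeasure_splicedMixture hU.1 hν.1)
    (lowerSemicomputable_splicedMixture hU.1 hν.1 he).isEnumerable
  -- K(j) is the price of the spliced mixture inside the prior; the 1 pays for the factor 1/2 in
  -- `predictive`.
  refine ⟨prefixK U j + 1, fun μ hμ hμe x y => ?_⟩
  have hM0 := (isSemimeasure_solomonoff hU hν.1).1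
  -- The empty continuation is treated apart because the splice factorizes only strictly beyond x.
  rcases eq_or_ne y [] with rfl | hy
  · have h1 : condProb μ x [] = 1 := by
      unfold condProb
      split_ifs with h
      · simp
      · rw [List.append_nil, div_self h]
    rw [h1, mul_one, List.append_nil]
    exact mul_le_of_le_one_left (hM0 x) (pow_le_one₀ (by norm_num) (by norm_num))
  obtain ⟨q, hq, hqK⟩ := hU.exists_condK x.length []
  obtain ⟨i, p, hi, hp, hpK⟩ := hU.exists_measureK
    (hν.2.2 μ hμ.isSemimeasure hμe) x
  have hcond0 : ∀ i, 0 ≤ lowerCond (ν i) x y := fun i => (hν.1 i).lowerCond_nonneg x y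
  have hpred : (2 : ℝ)⁻¹ ^ (1 + measureK U ν μ x) * condProb μ x y ≤ predictive U ν x y := by
    unfold predictive
    -- On a null string μ(·|x) is uniform by convention, and the uniform half of `predictive` covers
    -- it. Otherwise the shortest program for an index of μ given x supplies the required term.
    by_cases hx : μ x = 0
    · have h1 : condProb μ x y = uniform y := if_pos hx
      have h2 := (isMeasure_uniform (X := X)).1 y
      have h3 := haltSum_nonneg (U := U) (x := x) hcond0
      have h4 : (2 : ℝ)⁻¹ ^ (1 + measureK U ν μ x) ≤ 2⁻¹ := by
        rw [pow_add, pow_one]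
        exact mul_le_of_le_one_right (by norm_num) (pow_le_one₀ (by norm_num) (by norm_num))
      rw [h1]
      have := mul_le_mul_of_nonneg_right h4 h2
      linarith
    · have h1 := hU.1.le_haltSum hcond0 (fun i => (hν.1 i).lowerCond_le_one x y) hp
      rw [hi, hpK, hμ.lowerCond_eq hx] at h1
      have h2 := (isMeasure_uniform (X := X)).1 y
      rw [pow_add, pow_one]
      linarith
  have hspl : (2 : ℝ)⁻¹ ^ prefixK U x.length * (solomonoff U ν x * predictive U ν x y) ≤
      splicedMixture U ν (x ++ y) := by
    have h0 := fun l => isSemimeasure_splice_predictive hU.1 hν.1 (U := U) (ν := ν) l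
    have h1 := hU.1.le_haltSum (fun l => (h0 l).1 (x ++ y)) (fun l => (h0 l).le_one (x ++ y)) hq
    rw [splice_append _ hy, hqK] at h1
    refine le_trans (mul_le_mul_of_nonneg_left (mul_le_mul_of_nonneg_right
      (summable_solomonoff_and_le hU hν.1 x).2 ?_) (by positivity)) h1
    refine le_trans (mul_nonneg (by positivity) ?_) hpred
    unfold condProb
    split_ifs
    · positivity
    · exact div_nonneg (hμ.1 _) (hμ.1 _)
  have hdom := le_solomonoff hU hν.1 j (x ++ y)
  rw [hj] at hdom
  calc (2 : ℝ)⁻¹ ^ (prefixK U j + 1 + prefixK U x.length + measureK U ν μ x) *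
        (solomonoff U ν x * condProb μ x y)
      = (2 : ℝ)⁻¹ ^ prefixK U j * ((2 : ℝ)⁻¹ ^ prefixK U x.length * (solomonoff U ν x *
        ((2 : ℝ)⁻¹ ^ (1 + measureK U ν μ x) * condProb μ x y))) := by ring
    _ ≤ (2 : ℝ)⁻¹ ^ prefixK U j * ((2 : ℝ)⁻¹ ^ prefixK U x.length * (solomonoff U ν x *
        predictive U ν x y)) := by
        have := hM0 x
        gcongr
    _ ≤ (2 : ℝ)⁻¹ ^ prefixK U j * splicedMixture U ν (x ++ y) := by gcongr
    _ ≤ _ := hdom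

end Domination
/-! ### Inequalities between distances -/

section Distances

/-- The difference of the two sides has derivative (y - 1)³ / (y² (y + 2)²), hence its minimum, 0,
at y = 1. This rational bound leads to the constant 1/2 in `pinsker`. -/
theorem pade_le_log {x : ℝ} (hx : 0 < x) :
    (x - 1) * (5 * x + 1) / (2 * x * (x + 2)) ≤ Real.log x := by
  let f : ℝ → ℝ := fun x => Real.log x - (x - 1) * (5 * x + 1) / (2 * x * (x + 2))
  have hd : ∀ y, 0 < y → HasDerivAt f ((y - 1) ^ 3 / (y ^ 2 * (y + 2) ^ 2)) y := by
    intro y hy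
    have h1 : HasDerivAt (fun y : ℝ => (y - 1) * (5 * y + 1)) (1 * (5 * y + 1) + (y - 1) * 5) y := by
      have ha := (hasDerivAt_id y).sub_const 1
      have hb := ((hasDerivAt_id y).const_mul 5).add_const 1
      exact (ha.mul hb).congr_deriv (by simp)
    have h2 : HasDerivAt (fun y : ℝ => 2 * y * (y + 2)) (2 * (y + 2) + 2 * y * 1) y := by
      have ha := (hasDerivAt_id y).const_mul 2
      have hb := (hasDerivAt_id y).add_const 2
      exact (ha.mul hb).congr_deriv (by simp)
    have h3 := (Real.hasDerivAt_log hy.ne').sub (h1.div h2 (by positivity))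
    refine h3.congr_deriv ?_
    field_simp
    ring
  have hf1 : f 1 = 0 := by simp [f]
  have key : 0 ≤ f x := by
    rw [← hf1]
    rcases le_total x 1 with h | h
    · have hanti : AntitoneOn f (Set.Icc x 1) := by
        refine antitoneOn_of_deriv_nonpos (convex_Icc x 1)
          (fun y hy => (hd y (hx.trans_le hy.1)).continuousAt.continuousWithinAt) (fun y hy => ?_)
          fun y hy => ?_
        all_goals
          rw [interior_Icc] at hy
          have hy0 := hx.trans hy.1
        · exact (hd y hy0).differentiableAt.differentiableWithinAt
        · rw [(hd y hy0).deriv]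
          have : (y - 1) ^ 3 ≤ 0 := Odd.pow_nonpos (by decide) (by linarith [hy.2])
          exact div_nonpos_of_nonpos_of_nonneg this (by positivity)
      exact hanti ⟨le_rfl, h⟩ ⟨h, le_rfl⟩ h
    · have hmono : MonotoneOn f (Set.Icc 1 x) := by
        refine monotoneOn_of_deriv_nonneg (convex_Icc 1 x)
          (fun y hy => (hd y (one_pos.trans_le hy.1)).continuousAt.continuousWithinAt)
          (fun y hy => ?_) fun y hy => ?_
        all_goals
          rw [interior_Icc] at hy
          have hy0 : 0 < y := one_pos.trans hy.1
        · exact (hd y hy0).differentiableAt.differentiableWithinAt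
        · rw [(hd y hy0).deriv]
          have : 0 ≤ y - 1 := by linarith [hy.1]
          positivity
      exact hmono ⟨le_rfl, h⟩ ⟨h, le_rfl⟩ h
  exact sub_nonneg.1 key

/-- The logarithmic bound gives 3(p - q)² / (2(p + 2q)) on the left. Completing the square in S
turns this into an expression that is easily summed over the alphabet, with S left free. -/
theorem mul_abs_sub_le_klTerm {p q : ℝ} (hp : 0 ≤ p) (hq : 0 < q) (S : ℝ) :
    S * |p - q| - S ^ 2 * (p + 2 * q) / 6 ≤ p * Real.log (p / q) - p + q := by
  have hw : 0 < p + 2 * q := by positivity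
  have h1 : 3 * (p - q) ^ 2 / (2 * (p + 2 * q)) ≤ p * Real.log (p / q) - p + q := by
    rcases hp.eq_or_lt with rfl | hp
    · simp only [zero_mul, zero_sub, neg_sq, sub_zero, zero_add]
      rw [div_le_iff₀ (by positivity)]
      nlinarith [sq_nonneg q]
    · have h2 := mul_le_mul_of_nonneg_left (pade_le_log (div_pos hp hq)) hp.le
      have h3 : p * ((p / q - 1) * (5 * (p / q) + 1) / (2 * (p / q) * (p / q + 2))) =
          3 * (p - q) ^ 2 / (2 * (p + 2 * q)) + p - q := by
        field_simp
        ring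
      linarith
  refine le_trans ?_ h1
  rw [le_div_iff₀ (by positivity), ← sq_abs (p - q)]
  nlinarith [sq_nonneg (3 * |p - q| - S * (p + 2 * q))]

/-- Writing ln(p/q) = -2 ln √(q/p) and using ln u ≤ u - 1 gives p ln(p/q) ≥ 2p - 2√(pq). -/
theorem sq_sqrt_sub_le_klTerm {p q : ℝ} (hp : 0 ≤ p) (hq : 0 < q) :
    (√q - √p) ^ 2 ≤ p * Real.log (p / q) - p + q := by
  have hq' := Real.sq_sqrt hq.le
  have hp' := Real.sq_sqrt hp
  have hsq : 0 < √q := Real.sqrt_pos.2 hq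
  rcases hp.eq_or_lt with rfl | hp
  · simp [hq']
  · have hsp : 0 < √p := Real.sqrt_pos.2 hp
    have h1 : Real.log (p / q) = -(2 * Real.log (√q / √p)) := by
      rw [Real.log_div hp.ne' hq.ne', Real.log_div hsq.ne' hsp.ne', Real.log_sqrt hp.le,
        Real.log_sqrt hq.le]
      ring
    have h2 := Real.log_le_sub_one_of_pos (div_pos hsq hsp)
    have h3 : p * (√q / √p) = √p * √q := by
      nth_rw 1 [← hp']
      field_simp
    rw [h1]
    nlinarith [mul_le_mul_of_nonneg_left h2 hp.le]

variable {X : Type*} [Fintype X] {r m : X → ℝ}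

/-- A form of Pinsker's inequality for subprobabilities `r`. -/
theorem pinsker (hr0 : ∀ a, 0 < r a) (hr1 : ∑ a, r a ≤ 1) (hm0 : ∀ a, 0 ≤ m a)
    (hm1 : ∑ a, m a = 1) :
    1 / 2 * (∑ a, |r a - m a| + (1 - ∑ a, r a)) ^ 2 ≤ klDist r m := by
  set δ := 1 - ∑ a, r a with hδ
  set S := ∑ a, |r a - m a| + δ with hS
  -- Since the weights m + 2r have total 3 - 2δ, taking S itself as the free parameter yields S²/2 +
  -- δ(1 - S + S²/3) as a lower bound for the divergence. The quadratic in the bracket has negative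
  -- discriminant.
  have h1 := Finset.sum_le_sum fun a (_ : a ∈ Finset.univ) =>
    mul_abs_sub_le_klTerm (hm0 a) (hr0 a) S
  simp only [Finset.sum_sub_distrib, Finset.sum_add_distrib, ← Finset.mul_sum, ← Finset.sum_div,
    hm1] at h1
  have h2 : ∑ a, |m a - r a| = S - δ := by
    simp only [abs_sub_comm (m _), hS, add_sub_cancel_right]
  have h3 : ∑ a, r a = 1 - δ := by rw [hδ]; ring
  have hδ0 : 0 ≤ δ := by rw [hδ]; linarith
  rw [h2, h3] at h1
  have h4 : 0 ≤ δ * (1 - S + S ^ 2 / 3) :=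
    mul_nonneg hδ0 (by nlinarith [sq_nonneg (2 * S - 3)])
  unfold klDist
  nlinarith

theorem klDist_nonneg (hr0 : ∀ a, 0 < r a) (hr1 : ∑ a, r a ≤ 1) (hm0 : ∀ a, 0 ≤ m a)
    (hm1 : ∑ a, m a = 1) : 0 ≤ klDist r m :=
  le_trans (by positivity) (pinsker hr0 hr1 hm0 hm1)

theorem sqAbsDist_le_klDist (hr0 : ∀ a, 0 < r a) (hr1 : ∑ a, r a ≤ 1) (hm0 : ∀ a, 0 ≤ m a)
    (hm1 : ∑ a, m a = 1) : sqAbsDist r m ≤ klDist r m := by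
  refine le_trans ?_ (pinsker hr0 hr1 hm0 hm1)
  have h0 : 0 ≤ ∑ a, |r a - m a| := Finset.sum_nonneg fun _ _ => abs_nonneg _
  unfold sqAbsDist
  gcongr
  linarith

/-- The differences m - r add up to the deficit δ of r, so a single one is at most (T + δ)/2 in
absolute value, where T is the absolute distance. Hence the squares add up to at most T(T + δ)/2;
this is why `pinsker` keeps the deficit. -/
theorem sqDist_le_klDist (hr0 : ∀ a, 0 < r a) (hr1 : ∑ a, r a ≤ 1) (hm0 : ∀ a, 0 ≤ m a)
    (hm1 : ∑ a, m a = 1) : sqDist r m ≤ klDist r m := by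
  classical
  refine le_trans ?_ (pinsker hr0 hr1 hm0 hm1)
  set T := ∑ a, |r a - m a| with hT
  have hT0 : 0 ≤ T := Finset.sum_nonneg fun _ _ => abs_nonneg _
  have hsum : ∑ a, (m a - r a) = 1 - ∑ a, r a := by rw [Finset.sum_sub_distrib, hm1]
  have habs : ∀ a, 2 * |r a - m a| ≤ T + (1 - ∑ a, r a) := by
    intro a
    have h1 := Finset.add_sum_erase Finset.univ (fun a => m a - r a) (Finset.mem_univ a)
    have h2 := Finset.add_sum_erase Finset.univ (fun a => |r a - m a|) (Finset.mem_univ a)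
    have h3 := Finset.abs_sum_le_sum_abs (fun a => m a - r a) (Finset.univ.erase a)
    simp only [abs_sub_comm (m _)] at h3
    rw [hsum] at h1
    rw [← hT] at h2
    rcases abs_cases (r a - m a) with h | h <;>
      rcases abs_le.1 h3 with ⟨h4, h5⟩ <;> linarith
  calc sqDist r m = ∑ a, |r a - m a| * |r a - m a| := by
        simp only [sqDist, ← sq, sq_abs]
    _ ≤ ∑ a, (T + (1 - ∑ a, r a)) / 2 * |r a - m a| := by
        refine Finset.sum_le_sum fun a _ => mul_le_mul_of_nonneg_right ?_ (abs_nonneg _)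
        linarith [habs a]
    _ = (T + (1 - ∑ a, r a)) / 2 * T := by rw [Finset.mul_sum]
    _ ≤ _ := by nlinarith

theorem hellingerDist_le_klDist (hr0 : ∀ a, 0 < r a) (hr1 : ∑ a, r a ≤ 1) (hm0 : ∀ a, 0 ≤ m a)
    (hm1 : ∑ a, m a = 1) : hellingerDist r m ≤ klDist r m := by
  have h1 := Finset.sum_le_sum fun a (_ : a ∈ Finset.univ) =>
    sq_sqrt_sub_le_klTerm (hm0 a) (hr0 a)
  simp only [Finset.sum_sub_distrib, Finset.sum_add_distrib, hm1] at h1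
  unfold hellingerDist klDist
  linarith

theorem sum_abs_sub_le_two (hr0 : ∀ a, 0 ≤ r a) (hr1 : ∑ a, r a ≤ 1) (hm0 : ∀ a, 0 ≤ m a)
    (hm1 : ∑ a, m a = 1) : ∑ a, |r a - m a| ≤ 2 := by
  have : ∑ a, |r a - m a| ≤ ∑ a, (r a + m a) := Finset.sum_le_sum fun a _ =>
    abs_le.2 ⟨by linarith [hr0 a, hm0 a], by linarith [hr0 a, hm0 a]⟩
  rw [Finset.sum_add_distrib] at this
  linarith

theorem sqAbsDist_le_two (hr0 : ∀ a, 0 ≤ r a) (hr1 : ∑ a, r a ≤ 1) (hm0 : ∀ a, 0 ≤ m a)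
    (hm1 : ∑ a, m a = 1) : sqAbsDist r m ≤ 2 := by
  have h1 := sum_abs_sub_le_two hr0 hr1 hm0 hm1
  have h0 : 0 ≤ ∑ a, |r a - m a| := Finset.sum_nonneg fun _ _ => abs_nonneg _
  unfold sqAbsDist
  nlinarith

theorem sqDist_le_two (hr0 : ∀ a, 0 ≤ r a) (hr1 : ∑ a, r a ≤ 1) (hm0 : ∀ a, 0 ≤ m a)
    (hm1 : ∑ a, m a = 1) : sqDist r m ≤ 2 := by
  refine le_trans (Finset.sum_le_sum fun a _ => ?_) (sum_abs_sub_le_two hr0 hr1 hm0 hm1)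
  have h1 : r a ≤ 1 :=
    (Finset.single_le_sum (fun b _ => hr0 b) (Finset.mem_univ a)).trans hr1
  have h2 : m a ≤ 1 :=
    (Finset.single_le_sum (fun b _ => hm0 b) (Finset.mem_univ a)).trans hm1.le
  rw [← sq_abs, sq]
  exact mul_le_of_le_one_left (abs_nonneg _)
    (abs_le.2 ⟨by linarith [hr0 a], by linarith [hm0 a]⟩)

theorem hellingerDist_le_two (hr0 : ∀ a, 0 ≤ r a) (hr1 : ∑ a, r a ≤ 1) (hm0 : ∀ a, 0 ≤ m a)
    (hm1 : ∑ a, m a = 1) : hellingerDist r m ≤ 2 := by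
  have : hellingerDist r m ≤ ∑ a, (r a + m a) := Finset.sum_le_sum fun a _ => by
    nlinarith [Real.sq_sqrt (hr0 a), Real.sq_sqrt (hm0 a),
      mul_nonneg (Real.sqrt_nonneg (r a)) (Real.sqrt_nonneg (m a))]
  rw [Finset.sum_add_distrib] at this
  linarith

variable {Y : Type*} [Nonempty Y] {Loss : X → Y → ℝ}

/-- For each fixed action the expected losses under r and m differ by at most the absolute distance,
and this passes to the infima. -/
theorem bayesLoss_le_add (hL : ∀ a y, Loss a y ∈ Set.Icc (0 : ℝ) 1) (hr0 : ∀ a, 0 ≤ r a) :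
    bayesLoss Loss r ≤ bayesLoss Loss m + ∑ a, |r a - m a| := by
  have hbdd : BddBelow (Set.range fun y : Y => ∑ a, Loss a y * r a) :=
    ⟨0, by
      rintro _ ⟨y, rfl⟩
      exact Finset.sum_nonneg fun a _ => mul_nonneg (hL a y).1 (hr0 a)⟩
  rw [← sub_le_iff_le_add]
  refine le_ciInf fun y => ?_
  rw [sub_le_iff_le_add]
  refine (ciInf_le hbdd y).trans ?_
  rw [← Finset.sum_add_distrib]
  refine Finset.sum_le_sum fun a _ => ?_
  have h1 : Loss a y * (r a - m a) ≤ |r a - m a| :=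
    (mul_le_mul_of_nonneg_left (le_abs_self _) (hL a y).1).trans
      (mul_le_of_le_one_left (abs_nonneg _) (hL a y).2)
  linarith

theorem sqBayesRegret_le_sqAbsDist (hL : ∀ a y, Loss a y ∈ Set.Icc (0 : ℝ) 1)
    (hr0 : ∀ a, 0 ≤ r a) (hm0 : ∀ a, 0 ≤ m a) : sqBayesRegret Loss r m ≤ sqAbsDist r m := by
  have h1 := bayesLoss_le_add (m := m) hL hr0
  have h2 := bayesLoss_le_add (m := r) hL hm0
  simp only [abs_sub_comm (m _)] at h2
  unfold sqBayesRegret sqAbsDist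
  refine mul_le_mul_of_nonneg_left (sq_le_sq.2 ?_) (by norm_num)
  exact (abs_le.2 ⟨by linarith, by linarith⟩ : _ ≤ ∑ a, |r a - m a|).trans (le_abs_self _)

theorem mem_allDistances_nonneg_and_le (hL : ∀ a y, Loss a y ∈ Set.Icc (0 : ℝ) 1)
    {s : (X → ℝ) → (X → ℝ) → ℝ} (hs : s ∈ allDistances Loss)
    (hr0 : ∀ a, 0 < r a) (hr1 : ∑ a, r a ≤ 1) (hm0 : ∀ a, 0 ≤ m a)
    (hm1 : ∑ a, m a = 1) : 0 ≤ s r m ∧ s r m ≤ klDist r m := by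
  rcases hs with rfl | rfl | rfl | rfl | rfl
  · exact ⟨Finset.sum_nonneg fun _ _ => sq_nonneg _, sqDist_le_klDist hr0 hr1 hm0 hm1⟩
  · exact ⟨by unfold sqAbsDist; positivity, sqAbsDist_le_klDist hr0 hr1 hm0 hm1⟩
  · exact ⟨Finset.sum_nonneg fun _ _ => sq_nonneg _, hellingerDist_le_klDist hr0 hr1 hm0 hm1⟩
  · exact ⟨klDist_nonneg hr0 hr1 hm0 hm1, le_rfl⟩
  · exact ⟨by unfold sqBayesRegret; positivity,
      (sqBayesRegret_le_sqAbsDist hL (fun a => (hr0 a).le) hm0).trans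
        (sqAbsDist_le_klDist hr0 hr1 hm0 hm1)⟩

theorem mem_boundedDistances_le_two (hL : ∀ a y, Loss a y ∈ Set.Icc (0 : ℝ) 1)
    {s : (X → ℝ) → (X → ℝ) → ℝ} (hs : s ∈ boundedDistances Loss)
    (hr0 : ∀ a, 0 ≤ r a) (hr1 : ∑ a, r a ≤ 1) (hm0 : ∀ a, 0 ≤ m a)
    (hm1 : ∑ a, m a = 1) : s r m ≤ 2 := by
  rcases hs with rfl | rfl | rfl | rfl
  · exact sqDist_le_two hr0 hr1 hm0 hm1
  · exact sqAbsDist_le_two hr0 hr1 hm0 hm1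
  · exact hellingerDist_le_two hr0 hr1 hm0 hm1
  · exact (sqBayesRegret_le_sqAbsDist hL hr0 hm0).trans (sqAbsDist_le_two hr0 hr1 hm0 hm1)

omit [Nonempty Y] in
theorem boundedDistances_subset_allDistances : boundedDistances Loss ⊆ allDistances Loss := by
  rintro s (rfl | rfl | rfl | rfl) <;> simp [allDistances]

end Distances
/-! ### The chain rule -/

section ChainRule

variable {X : Type*} [Fintype X] {μ ρ : List X → ℝ}

theorem IsSemimeasure.condProb_nonneg (h : IsSemimeasure ρ) (x y : List X) :
    0 ≤ condProb ρ x y := by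
  unfold condProb
  split_ifs
  · positivity
  · exact div_nonneg (h.1 _) (h.1 _)

theorem condProb_pos (hρ : ∀ x, 0 < ρ x) (x y : List X) : 0 < condProb ρ x y := by
  rw [condProb, if_neg (hρ x).ne']
  exact div_pos (hρ _) (hρ _)

theorem IsSemimeasure.sum_condProb_le (h : IsSemimeasure ρ) (hρ : ∀ x, 0 < ρ x) (x : List X) :
    ∑ a, condProb ρ x [a] ≤ 1 := by
  simp only [condProb, if_neg (hρ x).ne', ← Finset.sum_div]
  exact div_le_one_of_le₀ (h.2.2 x) (hρ x).le

theorem IsMeasure.sum_condProb (h : IsMeasure μ) (x : List X) :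
    ∑ a, condProb μ x [a] = 1 := by
  have := h.nonempty
  by_cases hx : μ x = 0
  · simp [condProb, hx]
  · simp only [condProb, if_neg hx, ← Finset.sum_div, h.2.2, div_self hx]

/-- If ρ(x) = 0 both sides vanish, so the convention for null strings plays no role here. -/
theorem IsSemimeasure.mul_condProb (h : IsSemimeasure ρ) (x y : List X) :
    ρ x * condProb ρ x y = ρ (x ++ y) := by
  by_cases hx : ρ x = 0
  · rw [hx, zero_mul]
    exact le_antisymm (h.1 _) (hx ▸ h.append_le x y)
  · rw [condProb, if_neg hx, mul_div_cancel₀ _ hx]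

theorem IsSemimeasure.condProb_concat (h : IsSemimeasure ρ) (x y : List X) (a : X) :
    condProb ρ x (y ++ [a]) = condProb ρ x y * condProb ρ (x ++ y) [a] := by
  by_cases hx : ρ x = 0
  · have hxy : ρ (x ++ y) = 0 := le_antisymm (hx ▸ h.append_le x y) (h.1 _)
    simp [condProb, hx, hxy, pow_succ]
  · have h1 := h.mul_condProb (x ++ y) [a]
    have h2 : ∀ z, condProb ρ x z = ρ (x ++ z) / ρ x := fun z => if_neg hx
    rw [h2, h2, ← List.append_assoc, ← h1]
    ring

theorem IsMeasure.sum_condProb_ofFn (h : IsMeasure μ) (x : List X) (n : ℕ) :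
    ∑ y : Fin n → X, condProb μ x (List.ofFn y) = 1 := by
  induction n with
  | zero =>
    by_cases hx : μ x = 0 <;> simp [condProb, hx]
  | succ n ih =>
    rw [sum_ofFn_succ fun y => condProb μ x y, ← ih]
    refine Finset.sum_congr rfl fun y _ => ?_
    simp only [h.isSemimeasure.condProb_concat, ← Finset.mul_sum, h.sum_condProb, mul_one]

/-- The logarithm of a product of conditionals splits. Its first part does not involve the new
symbol, over which the conditional probabilities of μ add up to 1; the second part averages to the
one-step divergence. -/
theorem relEntropy_succ (hμ : IsMeasure μ) (h : IsSemimeasure ρ) (hρ : ∀ x, 0 < ρ x)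
    (x : List X) (n : ℕ) :
    relEntropy μ ρ x (n + 1) = relEntropy μ ρ x n + condExpect μ x n (deviation klDist ρ μ) := by
  unfold relEntropy condExpect
  rw [sum_ofFn_succ fun y => condProb μ x y * Real.log (condProb μ x y / condProb ρ x y),
    ← Finset.sum_add_distrib]
  refine Finset.sum_congr rfl fun y _ => ?_
  set y := List.ofFn y
  have key : ∀ a, condProb μ x (y ++ [a]) *
      Real.log (condProb μ x (y ++ [a]) / condProb ρ x (y ++ [a])) =
      condProb μ (x ++ y) [a] * (condProb μ x y * Real.log (condProb μ x y / condProb ρ x y)) +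
      condProb μ x y * (condProb μ (x ++ y) [a] *
        Real.log (condProb μ (x ++ y) [a] / condProb ρ (x ++ y) [a])) := by
    intro a
    rw [hμ.isSemimeasure.condProb_concat, h.condProb_concat]
    have h1 := (condProb_pos hρ x y).ne'
    have h2 := (condProb_pos hρ (x ++ y) [a]).ne'
    rcases eq_or_ne (condProb μ x y) 0 with h3 | h3
    · simp [h3]
    rcases eq_or_ne (condProb μ (x ++ y) [a]) 0 with h4 | h4
    · simp [h4]
    rw [mul_div_mul_comm, Real.log_mul (div_ne_zero h3 h1) (div_ne_zero h4 h2)]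
    ring
  simp only [key, Finset.sum_add_distrib, ← Finset.sum_mul, ← Finset.mul_sum, hμ.sum_condProb,
    one_mul]
  rfl

theorem relEntropy_eq_sum (hμ : IsMeasure μ) (h : IsSemimeasure ρ) (hρ : ∀ x, 0 < ρ x)
    (x : List X) (n : ℕ) :
    relEntropy μ ρ x n = ∑ k ∈ Finset.range n, condExpect μ x k (deviation klDist ρ μ) := by
  induction n with
  | zero =>
    have hμx : condProb μ x [] = 1 := by simpa using hμ.sum_condProb_ofFn x 0
    have hρx : condProb ρ x [] = 1 := by simp [condProb, (hρ x).ne']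
    simp [relEntropy, hμx, hρx]
  | succ n ih => rw [relEntropy_succ hμ h hρ, ih, Finset.sum_range_succ]

/-- Domination bounds the likelihood ratio by 2^N for every single continuation, hence also its mean
logarithm. -/
theorem relEntropy_le (hμ : IsMeasure μ) (hρ : ∀ x, 0 < ρ x) {x : List X} {N : ℕ}
    (h : ∀ y, (2 : ℝ)⁻¹ ^ N * (ρ x * condProb μ x y) ≤ ρ (x ++ y)) (n : ℕ) :
    relEntropy μ ρ x n ≤ N * Real.log 2 := by
  have hterm : ∀ y, condProb μ x y * Real.log (condProb μ x y / condProb ρ x y) ≤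
      condProb μ x y * (N * Real.log 2) := by
    intro y
    have h0 := hμ.isSemimeasure.condProb_nonneg x y
    rcases h0.eq_or_lt with h1 | h1
    · simp [← h1]
    · have h2 := condProb_pos hρ x y
      refine mul_le_mul_of_nonneg_left ?_ h0
      rw [← Real.log_pow]
      refine Real.log_le_log (div_pos h1 h2) ?_
      rw [div_le_iff₀ h2, condProb.eq_1 ρ, if_neg (hρ x).ne', mul_div_assoc',
        le_div_iff₀ (hρ x)]
      have h3 := mul_le_mul_of_nonneg_left (h y) (by positivity : (0 : ℝ) ≤ 2 ^ N)
      rw [← mul_assoc, ← mul_pow, mul_inv_cancel₀ two_ne_zero, one_pow, one_mul] at h3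
      linarith
  calc relEntropy μ ρ x n
      ≤ ∑ y : Fin n → X, condProb μ x (List.ofFn y) * (N * Real.log 2) :=
        Finset.sum_le_sum fun y _ => hterm _
    _ = N * Real.log 2 := by rw [← Finset.sum_mul, hμ.sum_condProb_ofFn, one_mul]

theorem IsMeasure.condExpect_mono (hμ : IsMeasure μ) {f g : List X → ℝ} (h : ∀ z, f z ≤ g z)
    (x : List X) (n : ℕ) : condExpect μ x n f ≤ condExpect μ x n g :=
  Finset.sum_le_sum fun _ _ =>
    mul_le_mul_of_nonneg_left (h _) (hμ.isSemimeasure.condProb_nonneg _ _)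

theorem IsMeasure.condExpect_nonneg (hμ : IsMeasure μ) {f : List X → ℝ} (h : ∀ z, 0 ≤ f z)
    (x : List X) (n : ℕ) : 0 ≤ condExpect μ x n f :=
  Finset.sum_nonneg fun _ _ => mul_nonneg (hμ.isSemimeasure.condProb_nonneg _ _) (h _)

theorem IsMeasure.condExpect_nil (hμ : IsMeasure μ) (n : ℕ) (f : List X → ℝ) :
    condExpect μ [] n f = expect μ n f := by
  simp [condExpect, expect, condProb, hμ.2.1]

theorem IsMeasure.expect_le (hμ : IsMeasure μ) {f : List X → ℝ} {c : ℝ} (h : ∀ z, f z ≤ c)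
    (n : ℕ) : expect μ n f ≤ c := by
  have h1 := hμ.sum_append [] n
  simp only [List.nil_append, hμ.2.1] at h1
  calc expect μ n f ≤ ∑ y : Fin n → X, μ (List.ofFn y) * c :=
        Finset.sum_le_sum fun _ _ => mul_le_mul_of_nonneg_left (h _) (hμ.1 _)
    _ = c := by rw [← Finset.sum_mul, h1, one_mul]

theorem IsMeasure.expect_add (hμ : IsMeasure μ) (l n : ℕ) (f : List X → ℝ) :
    expect μ (l + n) f = expect μ l fun x => condExpect μ x n f := by
  unfold expect condExpect
  rw [sum_ofFn_add fun z => μ z * f z]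
  simp only [Finset.mul_sum, ← mul_assoc, hμ.isSemimeasure.mul_condProb]

end ChainRule

/-- The linear lower bound forces T to infinity, so the minimum in (ii) is attained. -/
theorem exists_isLeast_range {T : ℕ → ℝ} (h : ∀ l : ℕ, (2 * l : ℝ) ≤ T l) :
    ∃ l, IsLeast (Set.range T) (T l) := by
  have h1 : Tendsto T cofinite atTop := by
    rw [Nat.cofinite_eq_atTop]
    exact tendsto_atTop_mono h
      (tendsto_natCast_atTop_atTop.const_mul_atTop two_pos)
  obtain ⟨l, hl⟩ := h1.exists_forall_le
  exact ⟨l, ⟨l, rfl⟩, by rintro _ ⟨k, rfl⟩; exact hl k⟩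

end FuturePrediction

/-! ### Assembly of the two bounds. -/

open FuturePrediction in
theorem corollary2 {X : Type*} [Fintype X] [Primcodable X]
    (U : List Bool × List X →. ℕ) (hU : IsUniversalPrefixMachine U)
    (ν : ℕ → List X → ℝ) (hν : IsEffectiveEnumeration ν) :
    ∃ C : ℝ, ∀ μ : List X → ℝ, IsComputableMeasure μ →
      ∀ (Y : Type*) [Nonempty Y] (Loss : X → Y → ℝ), (∀ a y, Loss a y ∈ Set.Icc (0 : ℝ) 1) →
        -- (i)
        (∀ x : List X, ∃ D : ℝ,
          Tendsto (relEntropy μ (solomonoff U ν) x) atTop (𝓝 D) ∧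
          (∀ s ∈ allDistances Loss, ∃ S : ℝ,
            HasSum (fun n => condExpect μ x n (deviation s (solomonoff U ν) μ)) S ∧ S ≤ D) ∧
          D ≤ ((measureK U ν μ x : ℝ) + prefixK U x.length) * Real.log 2 + C) ∧
        -- (ii)
        (∀ s ∈ boundedDistances Loss, ∃ S m : ℝ,
          HasSum (fun n => expect μ n (deviation s (solomonoff U ν) μ)) S ∧
          IsLeast (Set.range fun l : ℕ =>
            expect μ l (fun x => (measureK U ν μ x : ℝ) + prefixK U l) * Real.log 2 + 2 * l) m ∧
          S ≤ m + C) := by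
  -- Over the empty alphabet there are no measures, so any constant will do.
  rcases isEmpty_or_nonempty X with hX | hX
  · exact ⟨0, fun μ hμ => absurd hμ.1.nonempty (not_nonempty_iff.2 hX)⟩
  obtain ⟨c, hc⟩ := exists_solomonoff_dominates hU hν
  refine ⟨c * Real.log 2, fun μ hμ Y _ Loss hL => ?_⟩
  have hm := hμ.1
  have hM := isSemimeasure_solomonoff hU hν.1
  have hpos := solomonoff_pos hU hν
  set M := solomonoff U ν
  have hdev : ∀ s ∈ allDistances Loss, ∀ z, 0 ≤ deviation s M μ z ∧
      deviation s M μ z ≤ deviation klDist M μ z := fun s hs z =>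
    mem_allDistances_nonneg_and_le hL hs (fun a => condProb_pos hpos z [a])
      (hM.sum_condProb_le hpos z) (fun a => hm.isSemimeasure.condProb_nonneg z [a])
      (hm.sum_condProb z)
  have hdev2 : ∀ s ∈ boundedDistances Loss, ∀ z, deviation s M μ z ≤ 2 := fun s hs z =>
    mem_boundedDistances_le_two hL hs (fun a => (condProb_pos hpos z [a]).le)
      (hM.sum_condProb_le hpos z) (fun a => hm.isSemimeasure.condProb_nonneg z [a])
      (hm.sum_condProb z)
  have hi : ∀ x : List X, ∃ D : ℝ, Tendsto (relEntropy μ M x) atTop (𝓝 D) ∧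
      (∀ s ∈ allDistances Loss, ∃ S : ℝ,
        HasSum (fun n => condExpect μ x n (deviation s M μ)) S ∧ S ≤ D) ∧
      D ≤ ((measureK U ν μ x : ℝ) + prefixK U x.length) * Real.log 2 + c * Real.log 2 := by
    intro x
    have hkl0 : ∀ n, 0 ≤ condExpect μ x n (deviation klDist M μ) := hm.condExpect_nonneg
      (fun z => (hdev klDist (by simp [allDistances]) z).1) x
    have hle : ∀ n, ∑ k ∈ Finset.range n, condExpect μ x k (deviation klDist M μ) ≤
        ((c + prefixK U x.length + measureK U ν μ x : ℕ) : ℝ) * Real.log 2 := by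
      intro n
      rw [← relEntropy_eq_sum hm hM hpos]
      exact relEntropy_le hm hpos (fun y => hc μ hm hμ.2.1 x y) n
    have hsum := summable_of_sum_range_le hkl0 hle
    refine ⟨_, hsum.hasSum.tendsto_sum_nat.congr fun n => (relEntropy_eq_sum hm hM hpos x n).symm,
      fun s hs => ?_, ?_⟩
    · have hmono := hm.condExpect_mono (fun z => (hdev s hs z).2) x
      have hs' := Summable.of_nonneg_of_le
        (hm.condExpect_nonneg (fun z => (hdev s hs z).1) x) hmono hsum
      exact ⟨_, hs'.hasSum, Summable.tsum_le_tsum hmono hs' hsum⟩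
    · refine (Real.tsum_le_of_sum_range_le hkl0 hle).trans (le_of_eq ?_)
      push_cast
      ring
  refine ⟨hi, fun s hs => ?_⟩
  have hs' := boundedDistances_subset_allDistances hs
  obtain ⟨l, hl⟩ := exists_isLeast_range (T := fun l : ℕ =>
      expect μ l (fun x => (measureK U ν μ x : ℝ) + prefixK U l) * Real.log 2 + 2 * l) fun l => by
    have h1 : 0 ≤ expect μ l (fun x => (measureK U ν μ x : ℝ) + prefixK U l) :=
      Finset.sum_nonneg fun _ _ => mul_nonneg (hm.1 _) (by positivity)
    have h2 := mul_nonneg h1 (Real.log_nonneg one_le_two)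
    linarith
  choose D _ hDs hD using hi
  choose S hS hSD using fun x => hDs x s hs'
  have h0 := hS []
  simp only [hm.condExpect_nil] at h0
  refine ⟨_, _, h0, hl, ?_⟩
  -- By the tower property the tail from time l on is the mean, over pasts of length l, of the
  -- conditional series in (i).
  have htail : HasSum (fun n => expect μ (l + n) (deviation s M μ)) (expect μ l S) := by
    simp only [hm.expect_add]
    exact hasSum_sum fun y _ => (hS (List.ofFn y)).mul_left _
  -- The uniform bound 2 on these distances is the source of the term 2l.
  have hhead : ∑ n ∈ Finset.range l, expect μ n (deviation s M μ) ≤ 2 * l := by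
    refine (Finset.sum_le_card_nsmul _ _ 2 fun n _ => hm.expect_le (hdev2 s hs) n).trans ?_
    simp [mul_comm]
  have hsplit : S [] = ∑ n ∈ Finset.range l, expect μ n (deviation s M μ) + expect μ l S := by
    rw [← h0.tsum_eq, ← h0.summable.sum_add_tsum_nat_add l, ← htail.tsum_eq]
    simp only [add_comm l]
  have htot : ∑ y : Fin l → X, μ (List.ofFn y) = 1 := by
    simpa [hm.2.1] using hm.sum_append [] l
  have hexp : expect μ l S ≤
      expect μ l (fun x => (measureK U ν μ x : ℝ) + prefixK U l) * Real.log 2 +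
        c * Real.log 2 := by
    calc expect μ l S ≤ ∑ y : Fin l → X, (μ (List.ofFn y) *
          ((measureK U ν μ (List.ofFn y) : ℝ) + prefixK U l) * Real.log 2 +
          μ (List.ofFn y) * (c * Real.log 2)) := by
          refine Finset.sum_le_sum fun y _ => ?_
          have h1 := mul_le_mul_of_nonneg_left ((hSD (List.ofFn y)).trans (hD (List.ofFn y)))
            (hm.1 (List.ofFn y))
          rw [List.length_ofFn] at h1
          linarith
      _ = _ := by
          rw [Finset.sum_add_distrib, ← Finset.sum_mul, ← Finset.sum_mul, htot, one_mul]
          rfl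
  linarith
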